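/- Let $q_0,q_1,q_2$ be the vertices of an equilateral triangle, let $F_1,\dots,F_6$ be the contractions $F_j(x)=\tfrac13x+\tfrac23c_j$ of the plane, where $c_1,\dots,c_6$ are $q_0,q_1,q_2$ and the midpoints of the three sides, and let $X=SG_3$ be the attractor, $K_j=F_j(X)$, $V_0=\{q_0,q_1,q_2\}$, $V_{m+1}=\bigcup_jF_j(V_m)$. Two distinct points are $m$-neighbours, $x\sim_m y$, if they lie in one set $F_w(V_0)$, $|w|=m$. Write $p_0=\tfrac13(q_0+q_1+q_2)\in V_1$ for the centre point (the point of $V_1$ in three $1$-cells), let $\mu$ be the standard self-similar probability measure (weights $\tfrac16$) and $r=\tfrac7{15}$. Let $\mathcal E(u,v)=\lim_m\mathcal E_m(u,v)$ with $\mathcal E_m(u,v)=\tfrac12 r^{-m}\sum_{x\sim_m y}(u(x)-u(y))(v(x)-v(y))$ (sum over ordered pairs), whose domain consists of the continuous $u:X\to\mathbb C$ of finite energy. One says $\Delta u=f$ on $X$ (resp. on $K_j$), for $u$ in the domain of $\mathcal E$ and $f$ continuous, if $\mathcal E(u,v)=-\int_X fv\,d\mu$ for all $v$ in the domain of $\mathcal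 E$ vanishing on $V_0$ (resp. vanishing on $F_j(V_0)$ and outside $K_j$). The normal derivative at $q_i$ is $\partial_nu(q_i)=\lim_m r^{-m}\sum_{y\sim_m q_i}(u(q_i)-u(y))$, and $\partial_n^{K_j}u(F_jq_i)=r^{-1}\partial_n(u\circ F_j)(q_i)$. For $\Lambda\in\mathbb C$ and $p\in V_1\setminus V_0$ let $\psi_p^{(\Lambda)}$ be the solution of $(\Lambda-\Delta)\psi_p^{(\Lambda)}=0$ on each $K_j$ with $\psi_p^{(\Lambda)}(q)=\delta_{pq}$ for $q\in V_1$, and put $B^{(\Lambda)}_{pq}=\sum_{K_j\ni q}\partial_n^{K_j}\psi_p^{(\Lambda)}(q)$ for $q\in V_1$. Put $\lambda=-\tfrac r6\Lambda=-\tfrac7{90}\Lambda$, so that $-\Delta(\psi_p^{(\Lambda)}\circ F_j)=\lambda\,\psi_p^{(\Lambda)}\circ F_j$ on $X$ for each $j$, and assume that $-\lambda=\tfrac r6\Lambda$ is not an eigenvalue of $\Delta$ with Dirichlet boundary conditions on $V_0$. Let $(\lambda_m)_{m\ge0}$ be a complex sequence which defines $\lambda$ by spectral decimation, i.e. $$3(5-\lambda_{m+1})(4-\lambda_{m+1})(3-\lambda_{m+1})\lambda_{m+1}=(14-3\lambda_{m+1})\lambda_m\quad(m\ge0),\qquad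 \lambda=\tfrac32\lim_{m\to\infty}\left(\tfrac{90}7\right)^m\lambda_m,$$ with $\lambda_m\notin\{3,5,3\pm\sqrt5\}$ for $m\ge1$ and $\lambda_0\ne0$, and let $$\tau(\lambda)=\frac{2\lambda}{3\lambda_0}\prod_{j=1}^\infty\frac{(1-\frac{\lambda_j}4)(1-\frac{\lambda_j}6)}{1-\frac32\lambda_j+\frac{\lambda_j^2}4}.$$ Then the product converges, $B^{(\Lambda)}$ is well defined (each $\psi_p^{(\Lambda)}$ exists, the normal derivatives exist, and their sums depend only on $\Lambda$, $p$ and $q$), and $$B^{(\Lambda)}_{pq}=-r^{-1}\tau(\lambda)\ \text{ for } p\in V_1\setminus V_0,\ q\in V_1,\ p\sim_1q,\qquad B^{(\Lambda)}_{pp}=\begin{cases}\tfrac32r^{-1}(4-\lambda_0)\tau(\lambda),&p=p_0,\\ r^{-1}(4-\lambda_0)\tau(\lambda),&p\in V_1\setminus V_0,\ p\ne p_0.\end{cases}$$ -/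

import Mathlib

open Filter Topology MeasureTheory

noncomputable section

namespace SG3

/-- The Euclidean plane. -/
abbrev Plane : Type := EuclideanSpace ℝ (Fin 2)

/-- The boundary points `q₀, q₁, q₂`: the corners of an equilateral triangle of side one. -/
def corner : Fin 3 → Plane :=
  ![!₂[0, 0], !₂[1, 0], !₂[1 / 2, √3 / 2]]

/-- Fixed points of the six contractions: the three corners and the three midpoints of sides. -/
def fixedPt : Fin 6 → Plane :=
  ![corner 0, corner 1, corner 2,
    midpoint ℝ (corner 1) (corner 2), midpoint ℝ (corner 2) (corner 0),
    midpoint ℝ (corner 0) (corner 1)]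

/-- The iterated function system: six similarities of ratio `1/3`. -/
def F (j : Fin 6) (x : Plane) : Plane := (1 / 3 : ℝ) • x + (2 / 3 : ℝ) • fixedPt j

/-- The index of the contraction which fixes the corner `q_i`. -/
def cornerIndex (i : Fin 3) : Fin 6 := Fin.castLE (by norm_num) i

/-- `F_w = F_{w₁} ∘ ⋯ ∘ F_{w_m}` for a finite word `w`. -/
def wordMap : List (Fin 6) → Plane → Plane
  | [] => id
  | j :: w => F j ∘ wordMap w

/-- The boundary `F_w(V₀)` of the cell of the word `w`. -/
def cellBoundary (w : List (Fin 6)) : Set Plane := wordMap w '' Set.range corner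

/-- The vertex set `V_m`. -/
def V (m : ℕ) : Set Plane := {x | ∃ w : List (Fin 6), w.length = m ∧ x ∈ cellBoundary w}

/-- `x` and `y` are `m`-level neighbours. -/
def Neighbour (m : ℕ) (x y : Plane) : Prop :=
  x ≠ y ∧ ∃ w : List (Fin 6), w.length = m ∧ x ∈ cellBoundary w ∧ y ∈ cellBoundary w

/-- The fractal `SG₃`, the closure of the union of the `V_m`. -/
def X : Set Plane := closure (⋃ m, V m)

/-- The cell `K_w = F_w(X)`. -/
def cell (w : List (Fin 6)) : Set Plane := wordMap w '' X

/-- The centre point of `V₁`. -/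
def center : Plane := (1 / 3 : ℝ) • (corner 0 + corner 1 + corner 2)

/-- The point `lim F_{ω₀} ∘ ⋯ ∘ F_{ω_{n-1}}(x)` of `SG₃` coded by the infinite word `ω`. -/
def coding (ω : ℕ → Fin 6) : Plane := ∑' k, ((1 / 3 : ℝ) ^ k * (2 / 3)) • fixedPt (ω k)

/-- The standard self-similar measure (all six weights equal to `1/6`): the law of the point coded
by a sequence of independent uniformly distributed letters. -/
def μ : Measure Plane :=
  (Measure.infinitePi fun _ : ℕ => (PMF.uniformOfFintype (Fin 6)).toMeasure).map coding

/-- The energy renormalization constant. -/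
def r : ℂ := 7 / 15

/-- The renormalized graph energy of level `m`, as a bilinear form. At level `0` the graph is the
complete graph on `V₀`; the graph of level `m + 1` consists of the six images of the graph of
level `m`, and all conductances at level `m` are `r⁻ᵐ`. -/
def graphEnergy : ℕ → (Plane → ℂ) → (Plane → ℂ) → ℂ
  | 0, u, v => (1 / 2) * ∑ i, ∑ k,
      (u (corner i) - u (corner k)) * (v (corner i) - v (corner k))
  | m + 1, u, v => r⁻¹ * ∑ j, graphEnergy m (u ∘ F j) (v ∘ F j)

/-- `u` (of which only the values on `X` matter) is in the domain of the energy: it is continuous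
on `X` and its graph energies, which increase with the level, are bounded. -/
def InDomEnergy (u : Plane → ℂ) : Prop :=
  ContinuousOn u X ∧
    ∃ C : ℝ, ∀ m, ‖graphEnergy m u (fun x => starRingEnd ℂ (u x))‖ ≤ C

/-- `𝓔(u, v) = e`. -/
def HasEnergy (u v : Plane → ℂ) (e : ℂ) : Prop :=
  Tendsto (fun m => graphEnergy m u v) atTop (𝓝 e)

/-- `Δ u = f` on the cell `K_w`, weakly: `𝓔(u, v) = -∫ f v dμ` for all `v` in the domain of the
energy that vanish on the boundary of the cell and outside the cell. The empty word gives the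
Laplacian on `X`. -/
def HasLaplacianOn (w : List (Fin 6)) (u f : Plane → ℂ) : Prop :=
  InDomEnergy u ∧ ContinuousOn f X ∧
    ∀ v : Plane → ℂ, InDomEnergy v → (∀ x ∈ cellBoundary w, v x = 0) →
      (∀ x ∈ X \ cell w, v x = 0) → HasEnergy u v (-∫ x in X, f x * v x ∂μ)

/-- `κ` is a Dirichlet eigenvalue of `Δ` (so `κ` is a negative number). -/
def IsDirichletEigenvalue (κ : ℂ) : Prop :=
  ∃ u : Plane → ℂ, (∃ x ∈ X, u x ≠ 0) ∧ (∀ x ∈ V 0, u x = 0) ∧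
    HasLaplacianOn [] u (fun x => κ * u x)

/-- `∂ₙ u (q_i) = d`: the normal derivative at a boundary point of `X`. The `m`-level neighbours of
`q_i` are the points `F_i^m(q_k)` with `k ≠ i`. -/
def HasNormalDeriv (u : Plane → ℂ) (i : Fin 3) (d : ℂ) : Prop :=
  Tendsto (fun m : ℕ => (r ^ m)⁻¹ *
    ∑ k, (u (corner i) - u ((F (cornerIndex i))^[m] (corner k)))) atTop (𝓝 d)

/-- `d` is the normal derivative of `u` at the point `x = F_j(q_i)` with respect to the `1`-cell
`K_j`, that is, `r⁻¹` times the normal derivative of `u ∘ F_j` at `q_i`. -/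
def HasCellNormalDeriv (j : Fin 6) (u : Plane → ℂ) (x : Plane) (d : ℂ) : Prop :=
  ∃ (i : Fin 3) (e : ℂ), x = F j (corner i) ∧ HasNormalDeriv (u ∘ F j) i e ∧ d = r⁻¹ * e

/-- `b = ∑_{K_j ∋ x} ∂ₙ u (x)`: all the normal derivatives exist, and their sum over the
`1`-cells `K_j` that contain `x` is `b`. -/
def HasNormalDerivSum (u : Plane → ℂ) (x : Plane) (b : ℂ) : Prop :=
  ∃ d : Fin 6 → ℂ, (∀ j, x ∈ cell [j] → HasCellNormalDeriv j u x (d j)) ∧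
    (∀ j, x ∉ cell [j] → d j = 0) ∧ b = ∑ j, d j

/-- `ψ` is the solution `ψ_p^{(Λ)}` of the resolvent equation at level one:
`(Λ - Δ) ψ = 0` on each `1`-cell, and `ψ(q) = δ_{pq}` for `q ∈ V₁`. -/
def IsLevelOneSolution (Λ : ℂ) (p : Plane) (ψ : Plane → ℂ) : Prop :=
  (∀ j, HasLaplacianOn [j] ψ (fun x => Λ * ψ x)) ∧ ψ p = 1 ∧ ∀ q ∈ V 1, q ≠ p → ψ q = 0

/-- `B` is the matrix `B^{(Λ)}`: for `p ∈ V₁ \ V₀` the function `ψ_p^{(Λ)}` exists, and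
`B p q = ∑_{K_j ∋ q} ∂ₙ ψ_p^{(Λ)}(q)` for every such function and all `q ∈ V₁`. -/
def IsBMatrix (Λ : ℂ) (B : Plane → Plane → ℂ) : Prop :=
  ∀ p ∈ V 1 \ V 0, (∃ ψ, IsLevelOneSolution Λ p ψ) ∧
    ∀ ψ, IsLevelOneSolution Λ p ψ → ∀ q ∈ V 1, HasNormalDerivSum ψ q (B p q)

/-- The sequence `s` defines `lam` through spectral decimation: consecutive terms satisfy the
decimation relation, no term after the zeroth is one of the forbidden eigenvalues `3`, `5`,
`3 ± √5`, and `lam = (3/2) lim (90/7)^m s_m`. -/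
structure IsDecimationSequence (s : ℕ → ℂ) (lam : ℂ) : Prop where
  relation : ∀ m, 3 * (5 - s (m + 1)) * (4 - s (m + 1)) * (3 - s (m + 1)) * s (m + 1) =
    (14 - 3 * s (m + 1)) * s m
  ne_three : ∀ m, s (m + 1) ≠ 3
  ne_five : ∀ m, s (m + 1) ≠ 5
  ne_root : ∀ m, 4 - 6 * s (m + 1) + s (m + 1) ^ 2 ≠ 0
  limit : Tendsto (fun m : ℕ => (3 / 2) * (90 / 7 : ℂ) ^ m * s m) atTop (𝓝 lam)

/-- The factor with argument `z` of the infinite product in `τ`. -/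
def tauFactor (z : ℂ) : ℂ := (1 - z / 4) * (1 - z / 6) / (1 - 3 / 2 * z + z ^ 2 / 4)

/-- `τ(lam)`, for `lam` with the decimation sequence `s`. -/
def tau (s : ℕ → ℂ) (lam : ℂ) : ℂ :=
  2 * lam / (3 * s 0) * ∏' j : ℕ, tauFactor (s (j + 1))

end SG3

end

noncomputable section

namespace SG3

/-! Everything reduces to eigenfunctions on `X` with prescribed boundary values: composed with `F
j`, the function `ψ_p` satisfies `-Δu = λu` with values `0` or `1` at the corners.

Such functions come from spectral decimation. Given corner values and a parameter `z`, explicit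
rational weights solve the graph eigenvalue equation at the seven interior points of `V 1`. Measure
the defect of the equation at a corner by `flux`. If `z₀` and `z` satisfy the decimation relation,
refining by one level multiplies the corner defect by the scalar `fluxFactor z` and leaves no defect
at interior points (`sum_flux_extend`). Summation by parts at level `m` therefore leaves a mass term
`s m / 2` times a vertex sum and a boundary term with factor `∏ fluxFactor`
(`graphEnergy_eigenfun`). After renormalization the mass term tends to `λ ∫ u v`, because `6 / r =
90/7` is the decimation scale and vertex averages converge to the integral. The boundary factor
telescopes to `tau` (`fluxFactor_eq`, `tendsto_tau`). The limit is the Gauss–Green formula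
`hasEnergy_eigenfun`; the same recursion at a single corner gives the normal derivative `tau * flux`
(`hasNormalDeriv_eigenfun`).

The extension converges to a continuous function because `s m` decays geometrically, so the weights
are a summable perturbation of the harmonic ones, which contract oscillation by `11/15`. Off the
Dirichlet spectrum the eigenfunction is unique (`eqOn_eigenfun`), hence `B` is determined and its
entries are sums of `r⁻¹ * tau * flux` over cells. For indicator data each cell at `p` contributes
`2 - λ₀/2` at `p` and `-1` at each neighbour, so the entries follow by counting cells: three at the
centre, two at other points of `V 1 \ V 0`, one shared by neighbours. -/

/-! ### Barycentric coordinates and the combinatorics of `V 1`. -/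

/-- The barycentric coordinates with respect to the three corners. -/
def bary : Fin 3 → Plane → ℝ :=
  ![fun x => 1 - x 0 - x 1 / √3, fun x => x 0 - x 1 / √3, fun x => 2 * x 1 / √3]

/-- Twice the barycentric coordinates of the fixed points. -/
def fixedCoord : Fin 6 → Fin 3 → ℤ :=
  ![![2, 0, 0], ![0, 2, 0], ![0, 0, 2], ![0, 1, 1], ![1, 0, 1], ![1, 1, 0]]

/-- Three times the barycentric coordinates of the ten points of `V₁`: the corners, the six
interior points of the sides, the centre. -/
def nodeCoord : Fin 10 → Fin 3 → ℤ :=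
  ![![3, 0, 0], ![0, 3, 0], ![0, 0, 3], ![2, 1, 0], ![2, 0, 1], ![1, 2, 0], ![0, 2, 1],
    ![1, 0, 2], ![0, 1, 2], ![1, 1, 1]]

/-- The label in `Fin 10` of the point `F_j(q_k)` of `V₁`. -/
def node : Fin 6 → Fin 3 → Fin 10 :=
  ![![0, 3, 4], ![5, 1, 6], ![7, 8, 2], ![9, 6, 8], ![4, 9, 7], ![3, 5, 9]]

/-- The point of `V₁` with a given label. -/
def nodePt (n : Fin 10) : Plane := ∑ i, (nodeCoord n i / 3 : ℝ) • corner i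

lemma continuous_bary (i : Fin 3) : Continuous (bary i) := by
  fin_cases i <;> simp [bary] <;> fun_prop

lemma bary_sum (x : Plane) : bary 0 x + bary 1 x + bary 2 x = 1 := by
  simp [bary]; ring

lemma bary_add_smul (i : Fin 3) (x y : Plane) (a b : ℝ) (h : a + b = 1) :
    bary i (a • x + b • y) = a * bary i x + b * bary i y := by
  obtain rfl : b = 1 - a := by linarith
  fin_cases i <;> simp [bary] <;> ring

lemma bary_ext {x y : Plane} (h : ∀ i, bary i x = bary i y) : x = y := by
  have h3 : (√3 : ℝ) ≠ 0 := by positivity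
  have h1 := h 1
  have h2 := h 2
  simp only [bary, Matrix.cons_val_one, Matrix.cons_val_zero, Matrix.cons_val] at h1 h2
  have e1 : x 1 = y 1 := by field_simp at h2; linarith
  have e0 : x 0 = y 0 := by rw [e1] at h1; linarith
  ext i
  fin_cases i
  · exact e0
  · exact e1

lemma bary_corner (i k : Fin 3) : bary i (corner k) = if i = k then 1 else 0 := by
  have h3 : (√3 : ℝ) ≠ 0 := by positivity
  fin_cases i <;> fin_cases k <;> simp [bary, corner] <;> field_simp <;> norm_num

lemma bary_midpoint (i : Fin 3) (x y : Plane) :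
    bary i (midpoint ℝ x y) = (bary i x + bary i y) / 2 := by
  rw [midpoint_eq_smul_add, smul_add, bary_add_smul _ _ _ _ _ (by norm_num)]
  norm_num; ring

lemma bary_fixedPt (i : Fin 3) (j : Fin 6) : bary i (fixedPt j) = fixedCoord j i / 2 := by
  fin_cases j <;> simp only [fixedPt] <;> fin_cases i <;>
    simp [fixedCoord, bary_midpoint, bary_corner]

lemma bary_F (i : Fin 3) (j : Fin 6) (x : Plane) :
    bary i (F j x) = (bary i x + fixedCoord j i) / 3 := by
  rw [F, bary_add_smul _ _ _ _ _ (by norm_num), bary_fixedPt]; ring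

lemma nodeCoord_sum (n : Fin 10) : nodeCoord n 0 + nodeCoord n 1 + nodeCoord n 2 = 3 := by
  revert n; decide

lemma nodeCoord_injective : Function.Injective nodeCoord := by
  intro a b; revert a b; decide

lemma nodeCoord_node (j : Fin 6) (k i : Fin 3) :
    nodeCoord (node j k) i = (if i = k then 1 else 0) + fixedCoord j i := by
  revert j k i; decide

lemma bary_nodePt (i : Fin 3) (n : Fin 10) : bary i (nodePt n) = nodeCoord n i / 3 := by
  have hs : (nodeCoord n 0 : ℝ) + nodeCoord n 1 + nodeCoord n 2 = 3 := by
    exact_mod_cast nodeCoord_sum n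
  have h3 : (√3 : ℝ) ≠ 0 := by positivity
  fin_cases i <;> simp [bary, nodePt, corner, Fin.sum_univ_three] <;> field_simp <;> linarith

lemma nodePt_injective : Function.Injective nodePt := by
  intro a b h
  apply nodeCoord_injective
  funext i
  have := congrArg (bary i) h
  rw [bary_nodePt, bary_nodePt] at this
  have h' : (nodeCoord a i : ℝ) = nodeCoord b i := by linarith
  exact_mod_cast h'

lemma F_corner (j : Fin 6) (k : Fin 3) : F j (corner k) = nodePt (node j k) := by
  apply bary_ext
  intro i
  rw [bary_F, bary_nodePt, bary_corner, nodeCoord_node]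
  push_cast
  rfl

lemma corner_eq_nodePt (k : Fin 3) : corner k = nodePt (Fin.castLE (by norm_num) k) := by
  apply bary_ext
  intro i
  rw [bary_nodePt, bary_corner]
  fin_cases i <;> fin_cases k <;> simp [nodeCoord]

lemma center_eq_nodePt : center = nodePt 9 := by
  simp [center, nodePt, nodeCoord, Fin.sum_univ_three, smul_add]

lemma F_cornerIndex_corner (k : Fin 3) : F (cornerIndex k) (corner k) = corner k := by
  rw [F_corner, corner_eq_nodePt]
  congr 1
  revert k; decide

lemma corner_injective : Function.Injective corner := by
  intro a b h
  rw [corner_eq_nodePt, corner_eq_nodePt] at h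
  exact Fin.castLE_injective _ (nodePt_injective h)

lemma F_injective (j : Fin 6) : Function.Injective (F j) := by
  intro x y h
  apply bary_ext
  intro i
  have := congrArg (bary i) h
  rw [bary_F, bary_F] at this
  linarith

lemma continuous_F (j : Fin 6) : Continuous (F j) := by
  unfold F; fun_prop

lemma eq_corner_of_bary {x : Plane} (hx : ∀ i, 0 ≤ bary i x) {k : Fin 3} (h : bary k x = 1) :
    x = corner k := by
  have hs := bary_sum x
  have h0 := hx 0
  have h1 := hx 1
  have h2 := hx 2
  apply bary_ext
  intro i
  rw [bary_corner]
  fin_cases k <;> fin_cases i <;> simp at h ⊢ <;> linarith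

/-- Two distinct first-level triangles meet in vertices only. -/
lemma corner_of_F_eq_F {x y : Plane} (hx : ∀ i, 0 ≤ bary i x) (hy : ∀ i, 0 ≤ bary i y)
    {i j : Fin 6} (hij : i ≠ j) (h : F i x = F j y) :
    ∃ k l, x = corner k ∧ y = corner l ∧ node i k = node j l := by
  suffices ∃ k l, bary k x = 1 ∧ bary l y = 1 by
    obtain ⟨k, l, hk, hl⟩ := this
    have hk' := eq_corner_of_bary hx hk
    have hl' := eq_corner_of_bary hy hl
    refine ⟨k, l, hk', hl', nodePt_injective ?_⟩
    rw [← F_corner, ← F_corner, ← hk', ← hl', h]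
  -- Coordinates of `x` and `y` differ by integers that sum to zero and are not all zero. Since
  -- barycentric coordinates lie in `[0, 1]`, a difference of `±2` is impossible, while a difference
  -- of `±1` forces a coordinate equal to `1`; both signs occur, so both points are corners.
  have key : ∀ t, bary t x + fixedCoord i t = bary t y + fixedCoord j t := by
    intro t
    have := congrArg (bary t) h
    rw [bary_F, bary_F] at this
    linarith
  have sx := bary_sum x
  have sy := bary_sum y
  have x0 := hx 0
  have x1 := hx 1
  have x2 := hx 2
  have y0 := hy 0
  have y1 := hy 1
  have y2 := hy 2
  have k0 := key 0
  have k1 := key 1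
  have k2 := key 2
  clear key h hx hy
  fin_cases i <;> fin_cases j <;> first
    | exact absurd rfl hij
    | (simp [fixedCoord] at k0 k1 k2
       first
       | (exfalso; linarith)
       | (refine ⟨0, 1, ?_, ?_⟩ <;> linarith)
       | (refine ⟨0, 2, ?_, ?_⟩ <;> linarith)
       | (refine ⟨1, 0, ?_, ?_⟩ <;> linarith)
       | (refine ⟨1, 2, ?_, ?_⟩ <;> linarith)
       | (refine ⟨2, 0, ?_, ?_⟩ <;> linarith)
       | (refine ⟨2, 1, ?_, ?_⟩ <;> linarith))

lemma V_one_eq : V 1 = Set.range nodePt := by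
  ext x
  constructor
  · rintro ⟨w, hw, y, ⟨k, rfl⟩, rfl⟩
    obtain ⟨j, rfl⟩ := List.length_eq_one_iff.1 hw
    exact ⟨node j k, (F_corner j k).symm⟩
  · rintro ⟨n, rfl⟩
    have : ∀ n, ∃ j k, node j k = n := by decide
    obtain ⟨j, k, rfl⟩ := this n
    exact ⟨[j], rfl, corner k, ⟨k, rfl⟩, F_corner j k⟩

lemma V_zero_eq : V 0 = Set.range corner := by
  ext x
  constructor
  · rintro ⟨w, hw, y, ⟨k, rfl⟩, rfl⟩
    obtain rfl := List.length_eq_zero_iff.1 hw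
    exact ⟨k, rfl⟩
  · rintro ⟨k, rfl⟩
    exact ⟨[], rfl, corner k, ⟨k, rfl⟩, rfl⟩

/-! ### Coding of `X` by infinite words. -/

/-- The infinite word `jω`. -/
def cons (j : Fin 6) (ω : ℕ → Fin 6) : ℕ → Fin 6
  | 0 => j
  | n + 1 => ω n

lemma cons_head_tail (ω : ℕ → Fin 6) : cons (ω 0) (fun n => ω (n + 1)) = ω := by
  funext n; cases n <;> rfl

lemma cons_const (j : Fin 6) : cons j (fun _ => j) = fun _ => j := cons_head_tail fun _ => j

lemma continuous_cons (j : Fin 6) : Continuous (cons j) := by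
  refine continuous_pi fun n => ?_
  cases n with
  | zero => exact continuous_const
  | succ n => exact continuous_apply n

lemma exists_bound_fixedPt : ∃ C : ℝ, ∀ j, ‖fixedPt j‖ ≤ C :=
  ⟨∑ j, ‖fixedPt j‖, fun j =>
    Finset.single_le_sum (f := fun j => ‖fixedPt j‖) (fun _ _ => norm_nonneg _) (Finset.mem_univ j)⟩

lemma exists_summable_bound_coding : ∃ u : ℕ → ℝ, Summable u ∧ ∀ (k : ℕ) (ω : ℕ → Fin 6),
    ‖((1 / 3 : ℝ) ^ k * (2 / 3)) • fixedPt (ω k)‖ ≤ u k := by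
  obtain ⟨C, hC⟩ := exists_bound_fixedPt
  refine ⟨fun k => (1 / 3 : ℝ) ^ k * (2 / 3 * C),
    (summable_geometric_of_lt_one (by norm_num) (by norm_num)).mul_right _, fun k ω => ?_⟩
  rw [norm_smul, Real.norm_of_nonneg (by positivity), mul_assoc]
  exact mul_le_mul_of_nonneg_left (mul_le_mul_of_nonneg_left (hC _) (by norm_num)) (by positivity)

lemma summable_coding (ω : ℕ → Fin 6) :
    Summable fun k => ((1 / 3 : ℝ) ^ k * (2 / 3)) • fixedPt (ω k) := by
  obtain ⟨u, hu, h⟩ := exists_summable_bound_coding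
  exact Summable.of_norm_bounded hu fun k => h k ω

lemma continuous_coding : Continuous coding := by
  obtain ⟨u, hu, h⟩ := exists_summable_bound_coding
  refine continuous_tsum (fun k => ?_) hu h
  have h : Continuous fun ω : ℕ → Fin 6 => fixedPt (ω k) :=
    (continuous_of_discreteTopology (f := fixedPt)).comp (continuous_apply k)
  exact h.const_smul ((1 / 3 : ℝ) ^ k * (2 / 3))

lemma coding_cons (j : Fin 6) (ω : ℕ → Fin 6) : coding (cons j ω) = F j (coding ω) := by
  rw [coding, (summable_coding _).tsum_eq_zero_add, F, coding, ← (summable_coding ω).tsum_const_smul,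
    add_comm]
  congr 1
  · refine tsum_congr fun k => ?_
    rw [smul_smul]
    congr 1
    ring
  · simp [cons]

lemma coding_const_cornerIndex (k : Fin 3) : coding (fun _ => cornerIndex k) = corner k := by
  have h := coding_cons (cornerIndex k) fun _ => cornerIndex k
  rw [cons_const] at h
  apply bary_ext
  intro i
  have hi := congrArg (bary i) h
  rw [bary_F] at hi
  have hc := congrArg (bary i) (F_cornerIndex_corner k)
  rw [bary_F] at hc
  linarith

lemma mem_V_succ {m : ℕ} {x : Plane} :
    x ∈ V (m + 1) ↔ ∃ j, ∃ y ∈ V m, x = F j y := by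
  constructor
  · rintro ⟨w, hw, y, hy, rfl⟩
    cases w with
    | nil => simp at hw
    | cons j w => exact ⟨j, wordMap w y, ⟨w, by simpa using hw, y, hy, rfl⟩, rfl⟩
  · rintro ⟨j, y, ⟨w, hw, z, hz, rfl⟩, rfl⟩
    exact ⟨j :: w, by simpa using hw, z, hz, rfl⟩

lemma coding_mem_V (n : ℕ) (ω : ℕ → Fin 6) (h : ∀ k, n ≤ k → ω k = cornerIndex 0) :
    coding ω ∈ V n := by
  induction n generalizing ω with
  | zero =>
    rw [V_zero_eq]
    refine ⟨0, ?_⟩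
    rw [← coding_const_cornerIndex]
    congr 1
    funext k
    exact (h k (Nat.zero_le k)).symm
  | succ n ih =>
    rw [← cons_head_tail ω, coding_cons]
    exact mem_V_succ.2 ⟨_, _, ih _ fun k hk => h (k + 1) (by omega), rfl⟩

lemma V_subset_range_coding (m : ℕ) : V m ⊆ Set.range coding := by
  induction m with
  | zero =>
    rw [V_zero_eq]
    rintro _ ⟨k, rfl⟩
    exact ⟨_, coding_const_cornerIndex k⟩
  | succ m ih =>
    intro x hx
    obtain ⟨j, y, hy, rfl⟩ := mem_V_succ.1 hx
    obtain ⟨ω, rfl⟩ := ih hy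
    exact ⟨cons j ω, coding_cons j ω⟩

/-- The range of `coding` is compact and contains every `V m`. Conversely, replacing the tail of a
word by the constant letter of the corner `q₀` gives vertices that approximate the coded point. -/
lemma X_eq_range_coding : X = Set.range coding := by
  apply subset_antisymm
  · exact closure_minimal (Set.iUnion_subset V_subset_range_coding)
      (isCompact_range continuous_coding).isClosed
  · rintro _ ⟨ω, rfl⟩
    have ht : Tendsto (fun n : ℕ => coding fun k => if k < n then ω k else cornerIndex 0) atTop
        (𝓝 (coding ω)) := by
      refine (continuous_coding.tendsto ω).comp (tendsto_pi_nhds.2 fun k => ?_)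
      refine tendsto_const_nhds.congr' ?_
      filter_upwards [eventually_gt_atTop k] with n hn
      simp [hn]
    refine mem_closure_of_tendsto ht (Eventually.of_forall fun n => ?_)
    exact Set.mem_iUnion.2 ⟨n, coding_mem_V n _ fun k hk => by simp [hk]⟩

lemma coding_mem_X (ω : ℕ → Fin 6) : coding ω ∈ X := X_eq_range_coding ▸ ⟨ω, rfl⟩

lemma isCompact_X : IsCompact X := X_eq_range_coding ▸ isCompact_range continuous_coding

lemma V_subset_X (m : ℕ) : V m ⊆ X := X_eq_range_coding ▸ V_subset_range_coding m

lemma corner_mem_X (k : Fin 3) : corner k ∈ X := V_subset_X 0 (V_zero_eq ▸ ⟨k, rfl⟩)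

lemma F_mem_X {x : Plane} (hx : x ∈ X) (j : Fin 6) : F j x ∈ X := by
  rw [X_eq_range_coding] at hx ⊢
  obtain ⟨ω, rfl⟩ := hx
  exact ⟨cons j ω, coding_cons j ω⟩

lemma exists_F_eq {x : Plane} (hx : x ∈ X) : ∃ j, ∃ y ∈ X, F j y = x := by
  rw [X_eq_range_coding] at hx
  obtain ⟨ω, rfl⟩ := hx
  refine ⟨ω 0, coding fun n => ω (n + 1), coding_mem_X _, ?_⟩
  rw [← coding_cons, cons_head_tail]

lemma X_eq_iUnion : X = ⋃ j, F j '' X := by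
  ext x
  simp only [Set.mem_iUnion]
  constructor
  · exact fun hx => exists_F_eq hx
  · rintro ⟨j, y, hy, rfl⟩
    exact F_mem_X hy j

lemma bary_nonneg {x : Plane} (hx : x ∈ X) (i : Fin 3) : 0 ≤ bary i x := by
  have hV : ∀ m, ∀ y ∈ V m, 0 ≤ bary i y := by
    intro m
    induction m with
    | zero =>
      rw [V_zero_eq]
      rintro _ ⟨k, rfl⟩
      rw [bary_corner]
      split_ifs <;> norm_num
    | succ m ih =>
      intro x hx
      obtain ⟨j, y, hy, rfl⟩ := mem_V_succ.1 hx
      have h0 : ∀ j i, 0 ≤ fixedCoord j i := by decide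
      have h0' : (0 : ℝ) ≤ fixedCoord j i := by exact_mod_cast h0 j i
      have := ih y hy
      rw [bary_F]
      positivity
  have hcl : X ⊆ {y | 0 ≤ bary i y} :=
    closure_minimal (Set.iUnion_subset hV) (isClosed_le continuous_const (continuous_bary i))
  exact hcl hx

/-- Two distinct `1`-cells meet in points of `V₁` only. -/
lemma F_eq_F {x y : Plane} (hx : x ∈ X) (hy : y ∈ X) {i j : Fin 6} (hij : i ≠ j)
    (h : F i x = F j y) : ∃ k l, x = corner k ∧ y = corner l ∧ node i k = node j l :=
  corner_of_F_eq_F (bary_nonneg hx) (bary_nonneg hy) hij h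

/-- A vertex of `V 1` is a corner image in some cell; if that is another cell, the two cells meet
only at corner images. -/
lemma F_eq_nodePt {x : Plane} (hx : x ∈ X) {j : Fin 6} {n : Fin 10} (h : F j x = nodePt n) :
    ∃ k, x = corner k ∧ node j k = n := by
  have : ∀ n, ∃ i l, node i l = n := by decide
  obtain ⟨i, l, rfl⟩ := this n
  rw [← F_corner] at h
  by_cases hij : j = i
  · subst hij
    exact ⟨l, F_injective j h, rfl⟩
  · obtain ⟨k, l', hk, hl, hn⟩ := F_eq_F hx (corner_mem_X l) hij h
    exact ⟨k, hk, by rw [hn, corner_injective hl]⟩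

/-- A corner is coded by a constant word only. -/
lemma eq_const_of_coding_eq_corner {ω : ℕ → Fin 6} {k : Fin 3} (h : coding ω = corner k) :
    ω = fun _ => cornerIndex k := by
  have step : ∀ ω : ℕ → Fin 6, coding ω = corner k →
      ω 0 = cornerIndex k ∧ coding (fun n => ω (n + 1)) = corner k := by
    intro ω h
    rw [← cons_head_tail ω, coding_cons, corner_eq_nodePt] at h
    obtain ⟨l, hl, hn⟩ := F_eq_nodePt (coding_mem_X _) h
    have : ∀ (j : Fin 6) (l k : Fin 3), node j l = Fin.castLE (by norm_num) k →
        j = cornerIndex k ∧ l = k := by decide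
    obtain ⟨h1, h2⟩ := this _ _ _ hn
    exact ⟨h1, by rw [hl, h2]⟩
  funext n
  induction n generalizing ω with
  | zero => exact (step ω h).1
  | succ n ih => exact ih (step ω h).2

/-- Functions on `X` may be glued from functions on the `1`-cells which match on `V₁`. -/
lemma exists_glue (u : Fin 6 → Plane → ℂ) (hu : ∀ j, ContinuousOn (u j) X) (b : Fin 10 → ℂ)
    (hb : ∀ j k, u j (corner k) = b (node j k)) :
    ∃ ψ : Plane → ℂ, ContinuousOn ψ X ∧ ∀ j, ∀ x ∈ X, ψ (F j x) = u j x := by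
  classical
  let ψ : Plane → ℂ := fun x => if h : ∃ p : Fin 6 × Plane, p.2 ∈ X ∧ F p.1 p.2 = x then
    u h.choose.1 h.choose.2 else 0
  have hψ : ∀ j, ∀ x ∈ X, ψ (F j x) = u j x := by
    intro j x hx
    have h : ∃ p : Fin 6 × Plane, p.2 ∈ X ∧ F p.1 p.2 = F j x := ⟨(j, x), hx, rfl⟩
    have e : ψ (F j x) = u h.choose.1 h.choose.2 := dif_pos h
    rw [e]
    obtain ⟨h1, h2⟩ := h.choose_spec
    by_cases hj : h.choose.1 = j
    · rw [hj] at h2 ⊢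
      rw [F_injective j h2]
    · obtain ⟨k, l, hk, hl, hn⟩ := F_eq_F h1 hx hj h2
      have e' : u j x = u j (corner l) := by rw [← hl]
      rw [e', hk, hb, hb, hn]
  refine ⟨ψ, ?_, hψ⟩
  rw [X_eq_iUnion]
  -- The cells form a finite closed cover, so continuity may be checked cell by cell with the
  -- explicit inverse `y ↦ 3y - 2c_j` of `F j`.
  refine (locallyFinite_of_finite _).continuousOn_iUnion
    (fun j => (isCompact_X.image (continuous_F j)).isClosed) fun j => ?_
  have hinv : ∀ x, (3 : ℝ) • F j x - (2 : ℝ) • fixedPt j = x := by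
    intro x
    rw [F, smul_add, smul_smul, smul_smul]
    norm_num
  have : ContinuousOn (fun y => u j ((3 : ℝ) • y - (2 : ℝ) • fixedPt j)) (F j '' X) := by
    refine (hu j).comp (by fun_prop) ?_
    rintro _ ⟨x, hx, rfl⟩
    simpa only [hinv] using hx
  refine this.congr ?_
  rintro _ ⟨x, hx, rfl⟩
  simp only [hinv]
  exact hψ j x hx

/-! ### Self-similarity of the measure. -/

/-- The law of a sequence of independent uniformly distributed letters. -/
def letters : Measure (ℕ → Fin 6) :=
  Measure.infinitePi fun _ : ℕ => (PMF.uniformOfFintype (Fin 6)).toMeasure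

instance : IsProbabilityMeasure letters := by unfold letters; infer_instance

lemma μ_eq : μ = letters.map coding := rfl

lemma measurable_cons (j : Fin 6) : Measurable (cons j) := by
  refine measurable_pi_iff.2 fun n => ?_
  cases n with
  | zero => exact measurable_const
  | succ n => exact measurable_pi_apply n

lemma letters_pi (s : Finset ℕ) (t : ℕ → Set (Fin 6)) :
    letters (Set.pi s t) = ∏ i ∈ s, (PMF.uniformOfFintype (Fin 6)).toMeasure (t i) :=
  Measure.infinitePi_pi _ fun _ _ => MeasurableSet.of_discrete

/-- A product measure is determined by its values on finite boxes; conditioning on the first letter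
splits each box. -/
lemma letters_eq_sum : letters = (6⁻¹ : ENNReal) • ∑ j, letters.map (cons j) := by
  symm
  refine Measure.eq_infinitePi _ fun s t _ => ?_
  set Q := (PMF.uniformOfFintype (Fin 6)).toMeasure with hQ
  have hpt : ∀ A : Set (Fin 6), Q A = 6⁻¹ * ∑ j, A.indicator 1 j := by
    intro A
    rw [hQ, PMF.toMeasure_apply_fintype, Finset.mul_sum]
    refine Finset.sum_congr rfl fun j _ => ?_
    by_cases h : j ∈ A <;> simp [h]
  classical
  -- The index set is enlarged to an initial segment, with the full alphabet as the padding
  -- condition, so that the first letter is always present and can be split off.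
  obtain ⟨N, hN⟩ : ∃ N, s ⊆ Finset.range (N + 1) :=
    ⟨s.sup id, fun i hi => Finset.mem_range_succ_iff.2 (Finset.le_sup (f := id) hi)⟩
  let t' : ℕ → Set (Fin 6) := fun i => if i ∈ s then t i else Set.univ
  have hst : Set.pi (s : Set ℕ) t = Set.pi (Finset.range (N + 1) : Set ℕ) t' := by
    ext ω
    simp only [Set.mem_pi, Finset.mem_coe, t']
    constructor
    · intro h i _
      split_ifs with hi
      · exact h i hi
      · trivial
    · intro h i hi
      simpa [hi] using h i (hN hi)
  have hprod : ∏ i ∈ s, Q (t i) = ∏ i ∈ Finset.range (N + 1), Q (t' i) := by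
    rw [← Finset.prod_subset hN fun i _ hi => by simp [t', hi, hQ]]
    exact Finset.prod_congr rfl fun i hi => by simp [t', hi]
  have hm : MeasurableSet (Set.pi (Finset.range (N + 1) : Set ℕ) t') :=
    MeasurableSet.pi (Finset.range (N + 1)).countable_toSet fun _ _ => MeasurableSet.of_discrete
  have hpre : ∀ j, letters (cons j ⁻¹' Set.pi (Finset.range (N + 1) : Set ℕ) t') =
      (t' 0).indicator 1 j * ∏ i ∈ Finset.range N, Q (t' (i + 1)) := by
    intro j
    rw [← letters_pi (Finset.range N) fun i => t' (i + 1)]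
    by_cases hj : j ∈ t' 0
    · rw [Set.indicator_of_mem hj, Pi.one_apply, one_mul]
      congr 1
      ext ω
      simp only [Set.mem_preimage, Set.mem_pi, Finset.mem_coe, Finset.mem_range]
      constructor
      · exact fun h i hi => h (i + 1) (by omega)
      · intro h i hi
        cases i with
        | zero => exact hj
        | succ i => exact h i (by omega)
    · rw [Set.indicator_of_notMem hj, zero_mul]
      convert measure_empty (μ := letters)
      ext ω
      simp only [Set.mem_preimage, Set.mem_pi, Set.mem_empty_iff_false, iff_false]
      exact fun h => hj (h 0 (by simp))
  rw [hprod, hst, Finset.prod_range_succ', Measure.smul_apply, Measure.finsetSum_apply]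
  simp_rw [Measure.map_apply (measurable_cons _) hm, hpre]
  rw [← Finset.sum_mul, hpt (t' 0), smul_eq_mul]
  ring

lemma integrable_letters {h : (ℕ → Fin 6) → ℂ} (hh : Continuous h) : Integrable h letters :=
  hh.integrable_of_hasCompactSupport (HasCompactSupport.of_compactSpace h)

lemma integral_letters {h : (ℕ → Fin 6) → ℂ} (hh : Continuous h) :
    ∫ ω, h ω ∂letters = 6⁻¹ * ∑ j, ∫ ω, h (cons j ω) ∂letters := by
  have hj : ∀ j, ∫ ω, h ω ∂(letters.map (cons j)) = ∫ ω, h (cons j ω) ∂letters := fun j =>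
    integral_map (measurable_cons j).aemeasurable hh.aestronglyMeasurable
  have hi : ∀ j, Integrable h (letters.map (cons j)) := fun j =>
    (integrable_map_measure hh.aestronglyMeasurable (measurable_cons j).aemeasurable).2
      (integrable_letters (hh.comp (continuous_cons j)))
  conv_lhs => rw [letters_eq_sum]
  rw [integral_smul_measure, integral_finsetSum_measure fun j _ => hi j]
  simp_rw [hj]
  rw [Complex.real_smul]
  norm_num

lemma continuous_comp_coding {g : Plane → ℂ} (hg : ContinuousOn g X) :
    Continuous fun ω => g (coding ω) :=
  hg.comp_continuous continuous_coding coding_mem_X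

lemma integral_X {g : Plane → ℂ} (hg : ContinuousOn g X) :
    ∫ x in X, g x ∂μ = ∫ ω, g (coding ω) ∂letters := by
  have hX : MeasurableSet X := isCompact_X.isClosed.measurableSet
  have hμ : μ.restrict X = μ := by
    refine Measure.restrict_eq_self_of_ae_mem ?_
    rw [μ_eq]
    exact (ae_map_iff continuous_coding.aemeasurable hX).2 (ae_of_all _ coding_mem_X)
  have hm : AEStronglyMeasurable g (letters.map coding) := by
    rw [← μ_eq, ← hμ]
    exact hg.aestronglyMeasurable hX
  rw [hμ, μ_eq, integral_map continuous_coding.aemeasurable hm]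

lemma ContinuousOn.comp_F {g : Plane → ℂ} (hg : ContinuousOn g X) (j : Fin 6) :
    ContinuousOn (g ∘ F j) X :=
  hg.comp (continuous_F j).continuousOn fun _ hx => F_mem_X hx j

/-- Self-similarity of the measure. -/
lemma integral_X_eq_sum {g : Plane → ℂ} (hg : ContinuousOn g X) :
    ∫ x in X, g x ∂μ = 6⁻¹ * ∑ j, ∫ x in X, g (F j x) ∂μ := by
  rw [integral_X hg, integral_letters (continuous_comp_coding hg)]
  congr 1
  refine Finset.sum_congr rfl fun j _ => ?_
  rw [integral_X (g := fun x => g (F j x)) (ContinuousOn.comp_F hg j)]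
  simp_rw [coding_cons]

/-! ### Vertex averages and the integral. -/

/-- The sum of the values of `g` at the three vertices of all cells of level `m`. -/
def cellSum : ℕ → (Plane → ℂ) → ℂ
  | 0, g => ∑ i, g (corner i)
  | m + 1, g => ∑ j, cellSum m (g ∘ F j)

/-- There are `3 * 6 ^ m` summands, each compared with the mean of `g` over its own cell.
Self-similarity of the integral carries the bound from level to level. -/
lemma norm_cellSum_sub_le (m : ℕ) {ε : ℝ} (g : Plane → ℂ) (hg : ContinuousOn g X)
    (h : ∀ w : List (Fin 6), w.length = m → ∀ x ∈ X, ∀ y ∈ X,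
      ‖g (wordMap w x) - g (wordMap w y)‖ ≤ ε) :
    ‖cellSum m g - 3 * 6 ^ m * ∫ x in X, g x ∂μ‖ ≤ 3 * 6 ^ m * ε := by
  induction m generalizing g with
  | zero =>
    have h' : ∀ i, ‖g (corner i) - ∫ x in X, g x ∂μ‖ ≤ ε := by
      intro i
      rw [integral_X hg]
      have : g (corner i) - ∫ ω, g (coding ω) ∂letters =
          ∫ ω, (g (corner i) - g (coding ω)) ∂letters := by
        rw [integral_sub (integrable_const _) (integrable_letters (continuous_comp_coding hg))]
        simp
      rw [this]
      have := norm_integral_le_of_norm_le_const (μ := letters) (C := ε)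
        (f := fun ω => g (corner i) - g (coding ω))
        (ae_of_all _ fun ω => h [] rfl _ (corner_mem_X i) _ (coding_mem_X ω))
      simpa using this
    have e : cellSum 0 g - 3 * 6 ^ 0 * ∫ x in X, g x ∂μ =
        ∑ i, (g (corner i) - ∫ x in X, g x ∂μ) := by
      simp [cellSum]
    rw [e]
    refine (norm_sum_le_of_le _ fun i _ => h' i).trans ?_
    simp
  | succ m ih =>
    have e : cellSum (m + 1) g - 3 * 6 ^ (m + 1) * ∫ x in X, g x ∂μ =
        ∑ j, (cellSum m (g ∘ F j) - 3 * 6 ^ m * ∫ x in X, (g ∘ F j) x ∂μ) := by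
      rw [integral_X_eq_sum hg, Finset.sum_sub_distrib, ← Finset.mul_sum, cellSum]
      simp only [Function.comp_apply]
      ring
    rw [e]
    refine (norm_sum_le_of_le _ fun j _ => ih (g ∘ F j) (ContinuousOn.comp_F hg j) ?_).trans ?_
    · intro w hw x hx y hy
      exact h (j :: w) (by simp [hw]) x hx y hy
    · simp only [Finset.sum_const, Finset.card_univ, Fintype.card_fin, nsmul_eq_mul]
      apply le_of_eq
      push_cast
      ring

lemma dist_wordMap (w : List (Fin 6)) (x y : Plane) :
    dist (wordMap w x) (wordMap w y) = (1 / 3) ^ w.length * dist x y := by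
  induction w with
  | nil => simp [wordMap]
  | cons j w ih =>
    have : ∀ a b : Plane, dist (F j a) (F j b) = 1 / 3 * dist a b := by
      intro a b
      rw [F, F, dist_add_right, dist_smul₀, Real.norm_of_nonneg (by norm_num)]
    rw [wordMap, Function.comp_apply, Function.comp_apply, this, ih, List.length_cons, pow_succ]
    ring

lemma wordMap_mem_X (w : List (Fin 6)) {x : Plane} (hx : x ∈ X) : wordMap w x ∈ X := by
  induction w with
  | nil => exact hx
  | cons j w ih => exact F_mem_X ih j

/-- Vertex averages converge to the integral. -/
lemma tendsto_cellSum {g : Plane → ℂ} (hg : ContinuousOn g X) :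
    Tendsto (fun m => cellSum m g / (3 * 6 ^ m)) atTop (𝓝 (∫ x in X, g x ∂μ)) := by
  rw [Metric.tendsto_atTop]
  intro ε hε
  obtain ⟨δ, hδ, hu⟩ := Metric.uniformContinuousOn_iff.1
    (isCompact_X.uniformContinuousOn_of_continuous hg) (ε / 2) (half_pos hε)
  have hd : Tendsto (fun m : ℕ => (1 / 3 : ℝ) ^ m * Metric.diam X) atTop (𝓝 0) := by
    simpa using (tendsto_pow_atTop_nhds_zero_of_lt_one (r := (1 / 3 : ℝ)) (by norm_num)
      (by norm_num)).mul_const (Metric.diam X)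
  obtain ⟨N, hN⟩ := eventually_atTop.1 (hd.eventually_lt_const hδ)
  refine ⟨N, fun m hm => ?_⟩
  have hb := norm_cellSum_sub_le m (ε := ε / 2) g hg fun w hw x hx y hy => by
    rw [← dist_eq_norm]
    refine (hu _ (wordMap_mem_X w hx) _ (wordMap_mem_X w hy) ?_).le
    rw [dist_wordMap, hw]
    exact (mul_le_mul_of_nonneg_left (Metric.dist_le_diam_of_mem isCompact_X.isBounded hx hy)
      (by positivity)).trans_lt (hN m hm)
  have hne : (3 * 6 ^ m : ℂ) ≠ 0 := by simp
  have hn : ‖(3 * 6 ^ m : ℂ)‖ = 3 * 6 ^ m := by simp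
  rw [dist_eq_norm]
  have e : cellSum m g / (3 * 6 ^ m) - ∫ x in X, g x ∂μ =
      (cellSum m g - 3 * 6 ^ m * ∫ x in X, g x ∂μ) / (3 * 6 ^ m) := by
    field_simp
  rw [e, norm_div, hn, div_lt_iff₀ (by positivity)]
  have : (0 : ℝ) < 3 * 6 ^ m := by positivity
  nlinarith

/-! ### Graph energies and the energy domain. -/

lemma r_ne_zero : r ≠ 0 := by norm_num [r]

lemma graphEnergy_congr (m : ℕ) {u u' v v' : Plane → ℂ} (hu : Set.EqOn u u' X)
    (hv : Set.EqOn v v' X) : graphEnergy m u v = graphEnergy m u' v' := by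
  induction m generalizing u u' v v' with
  | zero => simp only [graphEnergy, hu (corner_mem_X _), hv (corner_mem_X _)]
  | succ m ih =>
    simp only [graphEnergy]
    congr 1
    exact Finset.sum_congr rfl fun j _ =>
      ih (fun x hx => hu (F_mem_X hx j)) fun x hx => hv (F_mem_X hx j)

lemma graphEnergy_sub_left (m : ℕ) (u u' v : Plane → ℂ) :
    graphEnergy m (fun x => u x - u' x) v = graphEnergy m u v - graphEnergy m u' v := by
  induction m generalizing u u' v with
  | zero =>
    simp only [graphEnergy, ← mul_sub, ← Finset.sum_sub_distrib]
    congr 1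
    refine Finset.sum_congr rfl fun i _ => Finset.sum_congr rfl fun k _ => ?_
    ring
  | succ m ih =>
    simp only [graphEnergy, ← mul_sub, ← Finset.sum_sub_distrib]
    congr 1
    exact Finset.sum_congr rfl fun j _ => ih _ _ _

lemma graphEnergy_zero_right (m : ℕ) (u : Plane → ℂ) : graphEnergy m u (fun _ => 0) = 0 := by
  induction m generalizing u with
  | zero => simp [graphEnergy]
  | succ m ih =>
    simp only [graphEnergy]
    rw [Finset.sum_eq_zero, mul_zero]
    exact fun j _ => ih (u ∘ F j)

lemma graphEnergy_succ_of_zero (m : ℕ) (u v : Plane → ℂ) (j : Fin 6)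
    (hv : ∀ i, i ≠ j → ∀ x ∈ X, v (F i x) = 0) :
    graphEnergy (m + 1) u v = r⁻¹ * graphEnergy m (u ∘ F j) (v ∘ F j) := by
  rw [graphEnergy, Finset.sum_eq_single j]
  · intro i _ hi
    rw [graphEnergy_congr m (v := v ∘ F i) (v' := fun _ => 0) (fun _ _ => rfl)
      (fun x hx => hv i hi x hx), graphEnergy_zero_right]
  · simp

/-- The energy `graphEnergy m u ū` as a real number. -/
def realEnergy : ℕ → (Plane → ℂ) → ℝ
  | 0, u => (1 / 2) * ∑ i, ∑ k, ‖u (corner i) - u (corner k)‖ ^ 2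
  | m + 1, u => (15 / 7) * ∑ j, realEnergy m (u ∘ F j)

/-- This turns membership in the energy domain into a bound on sums of nonnegative reals, which
passes to single cells and back. -/
lemma graphEnergy_conj (m : ℕ) (u : Plane → ℂ) :
    graphEnergy m u (fun x => starRingEnd ℂ (u x)) = realEnergy m u := by
  induction m generalizing u with
  | zero =>
    simp only [graphEnergy, realEnergy]
    push_cast
    congr 1
    refine Finset.sum_congr rfl fun i _ => Finset.sum_congr rfl fun k _ => ?_
    rw [← map_sub, Complex.mul_conj']
  | succ m ih =>
    simp only [graphEnergy, realEnergy]
    push_cast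
    congr 1
    · norm_num [r]
    · exact Finset.sum_congr rfl fun j _ => ih (u ∘ F j)

lemma realEnergy_nonneg (m : ℕ) (u : Plane → ℂ) : 0 ≤ realEnergy m u := by
  induction m generalizing u with
  | zero => simp only [realEnergy]; positivity
  | succ m ih =>
    simp only [realEnergy]
    have := Finset.sum_nonneg fun j (_ : j ∈ Finset.univ) => ih (u ∘ F j)
    positivity

lemma realEnergy_sub_le (m : ℕ) (u v : Plane → ℂ) :
    realEnergy m (fun x => u x - v x) ≤ 2 * realEnergy m u + 2 * realEnergy m v := by
  induction m generalizing u v with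
  | zero =>
    simp only [realEnergy]
    have : ∀ i k, ‖u (corner i) - v (corner i) - (u (corner k) - v (corner k))‖ ^ 2 ≤
        2 * ‖u (corner i) - u (corner k)‖ ^ 2 + 2 * ‖v (corner i) - v (corner k)‖ ^ 2 := by
      intro i k
      have h : u (corner i) - v (corner i) - (u (corner k) - v (corner k)) =
        (u (corner i) - u (corner k)) - (v (corner i) - v (corner k)) := by ring
      rw [h]
      have h1 := norm_sub_le (u (corner i) - u (corner k)) (v (corner i) - v (corner k))
      have h2 := norm_nonneg ((u (corner i) - u (corner k)) - (v (corner i) - v (corner k)))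
      nlinarith [sq_nonneg (‖u (corner i) - u (corner k)‖ - ‖v (corner i) - v (corner k)‖)]
    have h := Finset.sum_le_sum fun i (_ : i ∈ Finset.univ) =>
      Finset.sum_le_sum fun k (_ : k ∈ Finset.univ) => this i k
    simp only [Finset.sum_add_distrib, ← Finset.mul_sum] at h
    linarith
  | succ m ih =>
    simp only [realEnergy]
    have h := Finset.sum_le_sum fun j (_ : j ∈ Finset.univ) => ih (u ∘ F j) (v ∘ F j)
    simp only [Finset.sum_add_distrib, ← Finset.mul_sum] at h
    have e : ∀ j, (fun x => u x - v x) ∘ F j = fun x => (u ∘ F j) x - (v ∘ F j) x := fun _ => rfl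
    simp only [e]
    linarith

lemma inDomEnergy_iff {u : Plane → ℂ} :
    InDomEnergy u ↔ ContinuousOn u X ∧ ∃ C : ℝ, ∀ m, realEnergy m u ≤ C := by
  unfold InDomEnergy
  simp only [graphEnergy_conj, Complex.norm_real, Real.norm_of_nonneg (realEnergy_nonneg _ _)]

lemma InDomEnergy.continuousOn {u : Plane → ℂ} (hu : InDomEnergy u) : ContinuousOn u X := hu.1

lemma InDomEnergy.sub {u v : Plane → ℂ} (hu : InDomEnergy u) (hv : InDomEnergy v) :
    InDomEnergy fun x => u x - v x := by
  rw [inDomEnergy_iff] at *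
  obtain ⟨hu, C, hC⟩ := hu
  obtain ⟨hv, D, hD⟩ := hv
  refine ⟨hu.sub hv, 2 * C + 2 * D, fun m => (realEnergy_sub_le m u v).trans ?_⟩
  linarith [hC m, hD m]

lemma InDomEnergy.comp_F {u : Plane → ℂ} (hu : InDomEnergy u) (j : Fin 6) :
    InDomEnergy (u ∘ F j) := by
  rw [inDomEnergy_iff] at *
  obtain ⟨hu, C, hC⟩ := hu
  refine ⟨ContinuousOn.comp_F hu j, C, fun m => ?_⟩
  have h1 := hC (m + 1)
  rw [realEnergy] at h1
  have h2 := Finset.single_le_sum (f := fun j => realEnergy m (u ∘ F j))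
    (fun i _ => realEnergy_nonneg m (u ∘ F i)) (Finset.mem_univ j)
  have h3 := realEnergy_nonneg m (u ∘ F j)
  linarith

lemma InDomEnergy.of_comp_F {u : Plane → ℂ} (hc : ContinuousOn u X)
    (h : ∀ j, InDomEnergy (u ∘ F j)) : InDomEnergy u := by
  simp only [inDomEnergy_iff] at *
  choose C hC using fun j => (h j).2
  -- The cell bounds control levels from one upwards only; level zero enters separately.
  refine ⟨hc, max (realEnergy 0 u) (15 / 7 * ∑ j, C j), fun m => ?_⟩
  cases m with
  | zero => exact le_max_left _ _
  | succ m =>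
    refine le_max_of_le_right ?_
    rw [realEnergy]
    exact mul_le_mul_of_nonneg_left (Finset.sum_le_sum fun j _ => hC j m) (by norm_num)

lemma InDomEnergy.congr {u v : Plane → ℂ} (hu : InDomEnergy u) (h : Set.EqOn v u X) :
    InDomEnergy v := by
  obtain ⟨hu, C, hC⟩ := hu
  refine ⟨hu.congr h, C, fun m => ?_⟩
  rw [graphEnergy_congr m h fun x hx => congrArg (starRingEnd ℂ) (h hx)]
  exact hC m

lemma inDomEnergy_zero : InDomEnergy fun _ => 0 := by
  refine ⟨continuousOn_const, 0, fun m => ?_⟩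
  simp [graphEnergy_zero_right]

/-! ### Localization to a `1`-cell. -/

/-- Extension by zero from a `1`-cell. -/
lemma exists_extension {v : Plane → ℂ} (hv : InDomEnergy v) (h0 : ∀ k, v (corner k) = 0)
    (j : Fin 6) : ∃ v' : Plane → ℂ, InDomEnergy v' ∧ (∀ x ∈ X, v' (F j x) = v x) ∧
      ∀ i, i ≠ j → ∀ x ∈ X, v' (F i x) = 0 := by
  have hu : ∀ i, InDomEnergy (if i = j then v else fun _ => 0) := by
    intro i
    split_ifs
    · exact hv
    · exact inDomEnergy_zero
  obtain ⟨v', hc, hv'⟩ := exists_glue (fun i => if i = j then v else fun _ => 0)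
    (fun i => (hu i).continuousOn) (fun _ => 0) (by
      intro i k
      by_cases hi : i = j <;> simp [hi, h0])
  refine ⟨v', InDomEnergy.of_comp_F hc fun i => (hu i).congr fun x hx => hv' i x hx,
    fun x hx => ?_, fun i hi x hx => ?_⟩
  · simpa using hv' j x hx
  · simpa [hi] using hv' i x hx

lemma mem_cellBoundary_nil {x : Plane} : x ∈ cellBoundary [] ↔ ∃ k, corner k = x := by
  simp [cellBoundary, wordMap]

lemma mem_cellBoundary_singleton {j : Fin 6} {x : Plane} :
    x ∈ cellBoundary [j] ↔ ∃ k, F j (corner k) = x := by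
  simp [cellBoundary, wordMap]

/-- A function of `X` vanishing on the boundary of a `1`-cell and outside it vanishes on
all the other `1`-cells. -/
lemma eq_zero_on_other_cell {v : Plane → ℂ} {j : Fin 6} (hb : ∀ x ∈ cellBoundary [j], v x = 0)
    (ho : ∀ x ∈ X \ cell [j], v x = 0) {i : Fin 6} (hi : i ≠ j) {x : Plane} (hx : x ∈ X) :
    v (F i x) = 0 := by
  by_cases h : F i x ∈ cell [j]
  · obtain ⟨y, hy, hxy⟩ := h
    obtain ⟨l, k, hl, -, -⟩ := F_eq_F hy hx hi.symm hxy
    refine hb _ (mem_cellBoundary_singleton.2 ⟨l, ?_⟩)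
    rw [← hl]
    exact hxy
  · exact ho _ ⟨F_mem_X hx i, h⟩

lemma integral_X_of_zero {g : Plane → ℂ} (hg : ContinuousOn g X) (j : Fin 6)
    (h0 : ∀ i, i ≠ j → ∀ x ∈ X, g (F i x) = 0) :
    ∫ x in X, g x ∂μ = 6⁻¹ * ∫ x in X, g (F j x) ∂μ := by
  rw [integral_X_eq_sum hg, Finset.sum_eq_single j]
  · intro i _ hi
    exact setIntegral_eq_zero_of_forall_eq_zero fun x hx => h0 i hi x hx
  · simp

/-- Scaling of the Laplacian of an eigenfunction on a `1`-cell. -/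
lemma HasLaplacianOn.comp_F {ψ : Plane → ℂ} {Λ : ℂ} {j : Fin 6}
    (h : HasLaplacianOn [j] ψ fun x => Λ * ψ x) :
    HasLaplacianOn [] (ψ ∘ F j) fun x => r * (1 / 6) * Λ * (ψ ∘ F j) x := by
  obtain ⟨hψ, -, hE⟩ := h
  have hψj := hψ.comp_F j
  refine ⟨hψj, continuousOn_const.mul hψj.continuousOn, fun v hv hb _ => ?_⟩
  obtain ⟨v', hv', h1, h2⟩ := exists_extension hv
    (fun k => hb _ (mem_cellBoundary_nil.2 ⟨k, rfl⟩)) j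
  have key := hE v' hv' ?_ ?_
  · rw [integral_X_of_zero (g := fun x => Λ * ψ x * v' x) ((continuousOn_const.mul hψ.continuousOn).mul hv'.continuousOn) j
      fun i hi x hx => by simp only [h2 i hi x hx, mul_zero]] at key
    -- One level of energy on the cell costs a factor `r⁻¹` and the measure contributes `1/6`,
    -- whence the constant `r * (1/6)`.
    have key' := ((tendsto_add_atTop_iff_nat 1).2 key).const_mul r
    have hX : MeasurableSet X := isCompact_X.isClosed.measurableSet
    have e : -∫ x in X, r * (1 / 6) * Λ * (ψ ∘ F j) x * v x ∂μ =
        r * -(6⁻¹ * ∫ x in X, Λ * ψ (F j x) * v' (F j x) ∂μ) := by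
      rw [mul_neg, ← integral_const_mul, ← integral_const_mul]
      congr 1
      refine setIntegral_congr_fun hX fun x hx => ?_
      simp only [h1 x hx, Function.comp_apply]
      ring
    change Tendsto _ _ (𝓝 (-∫ x in X, r * (1 / 6) * Λ * (ψ ∘ F j) x * v x ∂μ))
    rw [e]
    refine key'.congr fun m => ?_
    rw [graphEnergy_succ_of_zero m ψ v' j h2, ← mul_assoc, mul_inv_cancel₀ r_ne_zero, one_mul]
    exact graphEnergy_congr m (fun _ _ => rfl) fun x hx => h1 x hx
  · intro x hx
    obtain ⟨k, rfl⟩ := mem_cellBoundary_singleton.1 hx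
    rw [h1 _ (corner_mem_X k)]
    exact hb _ (mem_cellBoundary_nil.2 ⟨k, rfl⟩)
  · rintro x ⟨hx, hxj⟩
    obtain ⟨i, y, hy, rfl⟩ := exists_F_eq hx
    refine h2 i ?_ y hy
    rintro rfl
    exact hxj ⟨y, hy, rfl⟩

/-! ### Algebra of spectral decimation. -/

/-- The common denominator of the coefficients of the eigenfunction extension. -/
def den (z : ℂ) : ℂ := 3 * (4 - 6 * z + z ^ 2) * (3 - z) * (5 - z)

/-- The coefficients expressing the values of a discrete eigenfunction at the points of `V₁`
through its values at the corners. -/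
def weight (z : ℂ) : Fin 10 → Fin 3 → ℂ :=
  let α := (96 - 109 * z + 33 * z ^ 2 - 3 * z ^ 3) / den z
  let β := (16 - 3 * z) * (3 - z) / den z
  let γ := (36 - 7 * z) / den z
  let δ := 4 * (3 - z) * (5 - z) / den z
  ![![1, 0, 0], ![0, 1, 0], ![0, 0, 1], ![α, β, γ], ![α, γ, β], ![β, α, γ], ![γ, α, β],
    ![β, γ, α], ![γ, β, α], ![δ, δ, δ]]

/-- The value at a point of `V₁` of the discrete eigenfunction with eigenvalue parameter `z` and
boundary values `a`. -/
def nodeVal (z : ℂ) (a : Fin 3 → ℂ) (n : Fin 10) : ℂ := ∑ i, weight z n i * a i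

/-- The boundary values on the `1`-cell `K_j` of the discrete eigenfunction with boundary
values `a`. -/
def extend (z : ℂ) (a : Fin 3 → ℂ) (j : Fin 6) : Fin 3 → ℂ := fun k => nodeVal z a (node j k)

/-- The defect of the discrete eigenvalue equation at a corner. -/
def flux (z : ℂ) (a : Fin 3 → ℂ) (k : Fin 3) : ℂ := (3 - z / 2) * a k - ∑ l, a l

/-- The factor by which `flux` is multiplied when passing to the next level. -/
def fluxFactor (z : ℂ) : ℂ := (14 - 3 * z) * (6 - z) / den z

/-- The parameters for which the extension of eigenfunctions is not defined are excluded. -/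
def Regular (z : ℂ) : Prop := z ≠ 3 ∧ z ≠ 5 ∧ 4 - 6 * z + z ^ 2 ≠ 0

/-- The decimation relation. -/
def DecimationRel (z₀ z : ℂ) : Prop :=
  3 * (5 - z) * (4 - z) * (3 - z) * z = (14 - 3 * z) * z₀

lemma Regular.den_ne_zero {z : ℂ} (hz : Regular z) : den z ≠ 0 := by
  obtain ⟨h3, h5, hr⟩ := hz
  have h3' : 3 - z ≠ 0 := sub_ne_zero.2 h3.symm
  have h5' : 5 - z ≠ 0 := sub_ne_zero.2 h5.symm
  unfold den
  simp [h3', h5', hr]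

lemma nodeVal_corner (z : ℂ) (a : Fin 3 → ℂ) (k : Fin 3) :
    nodeVal z a (Fin.castLE (by norm_num) k) = a k := by
  fin_cases k <;> simp [nodeVal, weight, Fin.sum_univ_three]

lemma extend_cornerIndex (z : ℂ) (a : Fin 3 → ℂ) (k : Fin 3) :
    extend z a (cornerIndex k) k = a k := by
  rw [extend, ← nodeVal_corner z a k]
  congr 1
  revert k; decide

/-- These compare coefficients at a corner: the first belongs to the value at that corner, the
second to the other two. The decimation relation makes both yield the same factor. -/
lemma flux_identities {z₀ z : ℂ} (hz : Regular z) (h : DecimationRel z₀ z) :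
    (2 - z / 2) - 2 * ((96 - 109 * z + 33 * z ^ 2 - 3 * z ^ 3) / den z) =
        fluxFactor z * (2 - z₀ / 2) ∧
      (16 - 3 * z) * (3 - z) / den z + (36 - 7 * z) / den z = fluxFactor z := by
  have hd := hz.den_ne_zero
  unfold DecimationRel at h
  constructor
  · rw [fluxFactor]
    field_simp
    unfold den
    linear_combination (z - 6) * h
  · rw [fluxFactor]
    field_simp
    ring

lemma flux_extend {z₀ z : ℂ} (hz : Regular z) (h : DecimationRel z₀ z) (a : Fin 3 → ℂ)
    (k : Fin 3) : flux z (extend z a (cornerIndex k)) k = fluxFactor z * flux z₀ a k := by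
  obtain ⟨e5, e6⟩ := flux_identities hz h
  fin_cases k <;>
    simp [flux, extend, cornerIndex, node, nodeVal, weight, Fin.sum_univ_three]
  · linear_combination a 0 * e5 - (a 1 + a 2) * e6
  · linear_combination a 1 * e5 - (a 0 + a 2) * e6
  · linear_combination a 2 * e5 - (a 0 + a 1) * e6

/-- The weights solve the eigenvalue equation at the interior points, so the defects of the cells
meeting there cancel. Only the corners survive, each lying in a single cell. -/
lemma sum_flux_extend {z₀ z : ℂ} (hz : Regular z) (h : DecimationRel z₀ z) (a : Fin 3 → ℂ)
    (v : Fin 10 → ℂ) : ∑ j, ∑ k, v (node j k) * flux z (extend z a j) k =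
      fluxFactor z * ∑ k, v (Fin.castLE (by norm_num) k) * flux z₀ a k := by
  obtain ⟨e5, e6⟩ := flux_identities hz h
  have hd := hz.den_ne_zero
  set α := (96 - 109 * z + 33 * z ^ 2 - 3 * z ^ 3) / den z with hα
  set β := (16 - 3 * z) * (3 - z) / den z with hβ
  set γ := (36 - 7 * z) / den z with hγ
  set δ := 4 * (3 - z) * (5 - z) / den z with hδ
  -- `e1`, `e2`, `e3` are the coefficients of the three corner values in the equation at a point on
  -- a side, and `e4` is the equation at the centre; symmetry covers the other points.
  have e1 : (3 - z) * α - 1 - β - δ = 0 := by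
    rw [hα, hβ, hδ]; field_simp; unfold den; ring
  have e2 : (4 - z) * β - γ - α - δ = 0 := by
    rw [hα, hβ, hγ, hδ]; field_simp; ring
  have e3 : (3 - z) * γ - β - δ = 0 := by
    rw [hβ, hγ, hδ]; field_simp; ring
  have e4 : (6 - 3 * z / 2) * δ - 2 * (α + β + γ) = 0 := by
    rw [hα, hβ, hγ, hδ]; field_simp; ring
  have hw : weight z = ![![1, 0, 0], ![0, 1, 0], ![0, 0, 1], ![α, β, γ], ![α, γ, β], ![β, α, γ],
    ![γ, α, β], ![β, γ, α], ![γ, β, α], ![δ, δ, δ]] := rfl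
  simp [flux, extend, node, nodeVal, hw, Fin.sum_univ_three, Fin.sum_univ_six]
  linear_combination v 3 * (a 0 * e1 + a 1 * e2 + a 2 * e3) +
    v 4 * (a 0 * e1 + a 2 * e2 + a 1 * e3) + v 5 * (a 1 * e1 + a 0 * e2 + a 2 * e3) +
    v 6 * (a 1 * e1 + a 2 * e2 + a 0 * e3) + v 7 * (a 2 * e1 + a 0 * e2 + a 1 * e3) +
    v 8 * (a 2 * e1 + a 1 * e2 + a 0 * e3) + v 9 * ((a 0 + a 1 + a 2) * e4) +
    v 0 * (a 0 * e5 - (a 1 + a 2) * e6) + v 1 * (a 1 * e5 - (a 0 + a 2) * e6) +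
    v 2 * (a 2 * e5 - (a 0 + a 1) * e6)

/-- Summation by parts on the triangle, valid for every `z`; it starts the induction for the
discrete Gauss–Green formula. -/
lemma graphEnergy_zero (z : ℂ) (u v : Plane → ℂ) :
    graphEnergy 0 u v = z / 2 * ∑ i, u (corner i) * v (corner i) +
      ∑ k, v (corner k) * flux z (fun i => u (corner i)) k := by
  simp only [graphEnergy, flux, Fin.sum_univ_three]
  ring

/-- The decimation relation trades `14 - 3 * z` for a multiple of `z / z₀`. In the product over
levels these ratios telescope and the remaining factors tend to `1`. -/
lemma fluxFactor_eq {z₀ z : ℂ} (hz : Regular z) (h : DecimationRel z₀ z) (h0 : z₀ ≠ 0) :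
    r⁻¹ * fluxFactor z = 90 / 7 * z / z₀ * tauFactor z := by
  have hd := hz.den_ne_zero
  have hr := hz.2.2
  have h3 : 3 - z ≠ 0 := sub_ne_zero.2 hz.1.symm
  have h5 : 5 - z ≠ 0 := sub_ne_zero.2 hz.2.1.symm
  unfold DecimationRel at h
  have e : 1 - 3 / 2 * z + z ^ 2 / 4 = (4 - 6 * z + z ^ 2) / 4 := by ring
  have hr2 : r⁻¹ = 15 / 7 := by norm_num [r]
  rw [fluxFactor, tauFactor, e, hr2, den]
  generalize 4 - 6 * z + z ^ 2 = D at *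
  field_simp
  linear_combination (90 * z - 540) * h

/-! ### Perturbation of the harmonic extension. -/

/-- Fifteen times the coefficients of the harmonic extension. -/
def harmonicWeight : Fin 10 → Fin 3 → ℤ :=
  ![![15, 0, 0], ![0, 15, 0], ![0, 0, 15], ![8, 4, 3], ![8, 3, 4], ![4, 8, 3], ![3, 8, 4],
    ![4, 3, 8], ![3, 4, 8], ![5, 5, 5]]

lemma weight_zero (n : Fin 10) (i : Fin 3) : weight 0 n i = harmonicWeight n i / 15 := by
  fin_cases n <;> fin_cases i <;> simp [weight, harmonicWeight, den] <;> norm_num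

lemma harmonicWeight_sum (n : Fin 10) :
    harmonicWeight n 0 + harmonicWeight n 1 + harmonicWeight n 2 = 15 := by
  revert n; decide

lemma differentiableAt_weight (n : Fin 10) (i : Fin 3) :
    DifferentiableAt ℂ (fun z => weight z n i) 0 := by
  have hd : 3 * (4 - 6 * (0 : ℂ) + 0 ^ 2) * (3 - 0) * (5 - 0) ≠ 0 := by norm_num
  fin_cases n <;> fin_cases i <;> simp [weight, den] <;>
    fun_prop (disch := exact hd)

/-- The total deviation of the extension coefficients from the harmonic ones. -/
def deviation (z : ℂ) : ℝ := ∑ n, ∑ i, ‖weight z n i - weight 0 n i‖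

lemma deviation_nonneg (z : ℂ) : 0 ≤ deviation z := by unfold deviation; positivity

lemma norm_nodeVal_sub_le (z : ℂ) (a : Fin 3 → ℂ) (n : Fin 10) :
    ‖nodeVal z a n - nodeVal 0 a n‖ ≤ deviation z * ‖a‖ := by
  rw [nodeVal, nodeVal, ← Finset.sum_sub_distrib]
  simp only [← sub_mul]
  calc ‖∑ i, (weight z n i - weight 0 n i) * a i‖
      ≤ ∑ i, ‖weight z n i - weight 0 n i‖ * ‖a‖ := norm_sum_le_of_le _ fun i _ => by
        rw [norm_mul]
        exact mul_le_mul_of_nonneg_left (norm_le_pi_norm a i) (norm_nonneg _)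
    _ = (∑ i, ‖weight z n i - weight 0 n i‖) * ‖a‖ := by rw [Finset.sum_mul]
    _ ≤ deviation z * ‖a‖ := by
        refine mul_le_mul_of_nonneg_right ?_ (norm_nonneg _)
        exact Finset.single_le_sum (f := fun n => ∑ i, ‖weight z n i - weight 0 n i‖)
          (fun _ _ => by positivity) (Finset.mem_univ n)

lemma harmonicWeight_nonneg (n : Fin 10) (i : Fin 3) : 0 ≤ harmonicWeight n i := by
  revert n i; decide

lemma norm_weight_zero (n : Fin 10) (i : Fin 3) :
    ‖weight 0 n i‖ = (harmonicWeight n i : ℝ) / 15 := by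
  have h : (0 : ℝ) ≤ harmonicWeight n i := by exact_mod_cast harmonicWeight_nonneg n i
  rw [weight_zero, norm_div, Complex.norm_intCast, abs_of_nonneg h]
  norm_num

lemma sum_norm_weight_zero (n : Fin 10) : ∑ i, ‖weight 0 n i‖ = 1 := by
  have h : ((harmonicWeight n 0 + harmonicWeight n 1 + harmonicWeight n 2 : ℤ) : ℝ) = 15 := by
    rw [harmonicWeight_sum]; norm_num
  push_cast at h
  simp only [norm_weight_zero, Fin.sum_univ_three]
  linarith

lemma sum_weight_zero (n : Fin 10) : ∑ i, weight 0 n i = 1 := by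
  have h : ((harmonicWeight n 0 + harmonicWeight n 1 + harmonicWeight n 2 : ℤ) : ℂ) = 15 := by
    rw [harmonicWeight_sum]; norm_num
  push_cast at h
  simp only [weight_zero, Fin.sum_univ_three]
  linear_combination h / 15

lemma norm_sum_weight_zero_le (n : Fin 10) (b : Fin 3 → ℂ) {C : ℝ} (hb : ∀ i, ‖b i‖ ≤ C) :
    ‖∑ i, weight 0 n i * b i‖ ≤ C := by
  calc ‖∑ i, weight 0 n i * b i‖ ≤ ∑ i, ‖weight 0 n i‖ * C := norm_sum_le_of_le _ fun i _ => by
        rw [norm_mul]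
        exact mul_le_mul_of_nonneg_left (hb i) (norm_nonneg _)
    _ = C := by rw [← Finset.sum_mul, sum_norm_weight_zero, one_mul]

lemma norm_extend_le (z : ℂ) (a : Fin 3 → ℂ) (j : Fin 6) :
    ‖extend z a j‖ ≤ (1 + deviation z) * ‖a‖ := by
  have hd := deviation_nonneg z
  refine (pi_norm_le_iff_of_nonneg (by positivity)).2 fun k => ?_
  have h1 := norm_nodeVal_sub_le z a (node j k)
  have h2 : ‖nodeVal 0 a (node j k)‖ ≤ ‖a‖ := norm_sum_weight_zero_le _ _ (norm_le_pi_norm a)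
  have h3 := norm_sub_norm_le (nodeVal z a (node j k)) (nodeVal 0 a (node j k))
  simp only [extend]
  linarith

lemma norm_nodeVal_zero_sub_le (a : Fin 3 → ℂ) {o : ℝ} (ho : ∀ k l, ‖a k - a l‖ ≤ o)
    (n : Fin 10) (l : Fin 3) : ‖nodeVal 0 a n - a l‖ ≤ o := by
  have h := norm_sum_weight_zero_le n (fun i => a i - a l) fun i => ho i l
  simp only [mul_sub, Finset.sum_sub_distrib, ← Finset.sum_mul, sum_weight_zero, one_mul] at h
  exact h

lemma norm_extend_sub_le (z : ℂ) (a : Fin 3 → ℂ) {o : ℝ} (ho : ∀ k l, ‖a k - a l‖ ≤ o)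
    (j : Fin 6) (k l : Fin 3) : ‖extend z a j k - a l‖ ≤ o + deviation z * ‖a‖ := by
  have h1 := norm_nodeVal_sub_le z a (node j k)
  have h2 := norm_nodeVal_zero_sub_le a ho (node j k) l
  have h3 := norm_sub_le_norm_sub_add_norm_sub (nodeVal z a (node j k))
    (nodeVal 0 a (node j k)) (a l)
  simp only [extend]
  linarith

/-- As each row of weights sums to `15`, the third corner can be eliminated, and two differences
suffice. The bound `11` is attained between a corner and an adjacent side point. -/
lemma harmonicWeight_contraction (j : Fin 6) (k l : Fin 3) :
    |harmonicWeight (node j k) 0 - harmonicWeight (node j l) 0| +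
      |harmonicWeight (node j k) 1 - harmonicWeight (node j l) 1| ≤ 11 := by
  revert j k l; decide

/-- One step of the extension contracts the oscillation, up to the deviation from the
harmonic case. -/
lemma extend_osc_le (z : ℂ) (a : Fin 3 → ℂ) {o : ℝ} (ho : ∀ k l, ‖a k - a l‖ ≤ o)
    (j : Fin 6) (k l : Fin 3) :
    ‖extend z a j k - extend z a j l‖ ≤ 11 / 15 * o + 2 * (deviation z * ‖a‖) := by
  have h0 : ‖nodeVal 0 a (node j k) - nodeVal 0 a (node j l)‖ ≤ 11 / 15 * o := by
    set p := harmonicWeight (node j k) with hp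
    set q := harmonicWeight (node j l) with hq
    have sp : ((p 0 + p 1 + p 2 : ℤ) : ℂ) = 15 := by rw [hp, harmonicWeight_sum]; norm_num
    have sq : ((q 0 + q 1 + q 2 : ℤ) : ℂ) = 15 := by rw [hq, harmonicWeight_sum]; norm_num
    push_cast at sp sq
    have e : nodeVal 0 a (node j k) - nodeVal 0 a (node j l) =
        (((p 0 - q 0 : ℤ) : ℂ) / 15) * (a 0 - a 2) + (((p 1 - q 1 : ℤ) : ℂ) / 15) * (a 1 - a 2) := by
      simp only [nodeVal, weight_zero, Fin.sum_univ_three, ← hp, ← hq]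
      push_cast
      linear_combination a 2 / 15 * sp - a 2 / 15 * sq
    have hc : ((|p 0 - q 0| + |p 1 - q 1| : ℤ) : ℝ) ≤ 11 := by
      exact_mod_cast harmonicWeight_contraction j k l
    rw [Int.cast_add] at hc
    have hn : ∀ t : ℤ, ‖(t : ℂ) / 15‖ = ((|t| : ℤ) : ℝ) / 15 := by
      intro t
      rw [norm_div, Complex.norm_intCast, Int.cast_abs]
      norm_num
    have ho0 : 0 ≤ o := (norm_nonneg _).trans (ho 0 0)
    rw [e]
    refine (norm_add_le _ _).trans ?_
    rw [norm_mul, norm_mul, hn, hn]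
    have t0 : (0 : ℝ) ≤ ((|p 0 - q 0| : ℤ) : ℝ) / 15 := by positivity
    have t1 : (0 : ℝ) ≤ ((|p 1 - q 1| : ℤ) : ℝ) / 15 := by positivity
    have m0 := mul_le_mul_of_nonneg_left (ho 0 2) t0
    have m1 := mul_le_mul_of_nonneg_left (ho 1 2) t1
    nlinarith
  have h1 := norm_nodeVal_sub_le z a (node j k)
  have h2 := norm_nodeVal_sub_le z a (node j l)
  have e : extend z a j k - extend z a j l =
      (nodeVal z a (node j k) - nodeVal 0 a (node j k)) +
      (nodeVal 0 a (node j k) - nodeVal 0 a (node j l)) -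
      (nodeVal z a (node j l) - nodeVal 0 a (node j l)) := by
    simp only [extend]; ring
  rw [e]
  refine (norm_sub_le _ _).trans ?_
  have := norm_add_le (nodeVal z a (node j k) - nodeVal 0 a (node j k))
    (nodeVal 0 a (node j k) - nodeVal 0 a (node j l))
  linarith

lemma summable_of_contraction {o d : ℕ → ℝ} {θ : ℝ} (hθ : θ < 1) (ho : ∀ m, 0 ≤ o m)
    (hd0 : ∀ m, 0 ≤ d m) (hd : Summable d) (h : ∀ m, o (m + 1) ≤ θ * o m + d m) : Summable o := by
  refine summable_of_sum_range_le (c := (o 0 + ∑' m, d m) / (1 - θ)) ho fun n => ?_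
  rw [le_div_iff₀ (by linarith)]
  have h1 : ∑ i ∈ Finset.range n, o i ≤ ∑ i ∈ Finset.range (n + 1), o i := by
    rw [Finset.sum_range_succ]; linarith [ho n]
  have h2 : ∑ i ∈ Finset.range (n + 1), o i ≤
      θ * ∑ i ∈ Finset.range n, o i + ∑ i ∈ Finset.range n, d i + o 0 := by
    rw [Finset.sum_range_succ', Finset.mul_sum, ← Finset.sum_add_distrib]
    exact add_le_add (Finset.sum_le_sum fun i _ => h i) le_rfl
  have h3 := hd.sum_le_tsum (Finset.range n) fun i _ => hd0 i
  nlinarith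

/-! ### Construction of eigenfunctions on `X`. -/

/-- The boundary values on the cells `K_{ω₀ ⋯ ω_{m-1}}` of the function with boundary values `a`
on `X` which is obtained by successive extension with parameters `s 1, s 2, …`. -/
def cellData (s : ℕ → ℂ) (a : Fin 3 → ℂ) (ω : ℕ → Fin 6) : ℕ → Fin 3 → ℂ
  | 0 => a
  | m + 1 => extend (s (m + 1)) (cellData s a ω m) (ω m)

lemma continuous_cellData (s : ℕ → ℂ) (a : Fin 3 → ℂ) (m : ℕ) :
    Continuous fun ω => cellData s a ω m := by
  induction m with
  | zero => exact continuous_const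
  | succ m ih =>
    refine continuous_pi fun k => ?_
    simp only [cellData, extend, nodeVal]
    refine continuous_finsetSum _ fun i _ => ?_
    have h : Continuous fun ω : ℕ → Fin 6 => weight (s (m + 1)) (node (ω m) k) i :=
      (continuous_of_discreteTopology
        (f := fun j : Fin 6 => weight (s (m + 1)) (node j k) i)).comp (continuous_apply m)
    exact h.mul ((continuous_apply i).comp ih)

lemma cellData_cons (s : ℕ → ℂ) (a : Fin 3 → ℂ) (j : Fin 6) (ω : ℕ → Fin 6) (m : ℕ) :
    cellData s a (cons j ω) (m + 1) =
      cellData (fun n => s (n + 1)) (extend (s 1) a j) ω m := by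
  induction m with
  | zero => rfl
  | succ m ih => rw [cellData, ih, cellData]; rfl

/-- A sequence of parameters along which eigenfunctions can be extended to `X`. -/
structure Admissible (s : ℕ → ℂ) : Prop where
  rel : ∀ m, DecimationRel (s m) (s (m + 1))
  regular : ∀ m, Regular (s (m + 1))
  summable : Summable fun m => deviation (s (m + 1))

lemma Admissible.shift {s : ℕ → ℂ} (hs : Admissible s) : Admissible fun n => s (n + 1) :=
  ⟨fun m => hs.rel (m + 1), fun m => hs.regular (m + 1),
    (summable_nat_add_iff (f := fun m => deviation (s (m + 1))) 1).2 hs.summable⟩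

/-- The norm grows by at most `1 + deviation ≤ exp deviation` per level, and the deviations are
summable. -/
lemma exists_norm_cellData_le {s : ℕ → ℂ} (hs : Admissible s) (a : Fin 3 → ℂ) :
    ∃ C : ℝ, 0 ≤ C ∧ ∀ ω m, ‖cellData s a ω m‖ ≤ C := by
  refine ⟨Real.exp (∑' m, deviation (s (m + 1))) * ‖a‖, by positivity, fun ω m => ?_⟩
  have h : ‖cellData s a ω m‖ ≤
      Real.exp (∑ i ∈ Finset.range m, deviation (s (i + 1))) * ‖a‖ := by
    induction m with
    | zero => simp [cellData]
    | succ m ih =>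
      rw [cellData, Finset.sum_range_succ, Real.exp_add,
        mul_comm (Real.exp _) (Real.exp (deviation _)), mul_assoc]
      refine (norm_extend_le _ _ _).trans ?_
      have hd := deviation_nonneg (s (m + 1))
      exact mul_le_mul (by linarith [Real.add_one_le_exp (deviation (s (m + 1)))]) ih
        (norm_nonneg _) (Real.exp_pos _).le
  refine h.trans (mul_le_mul_of_nonneg_right (Real.exp_le_exp.2 ?_) (norm_nonneg _))
  exact hs.summable.sum_le_tsum _ fun i _ => deviation_nonneg _

lemma exists_osc_cellData_le {s : ℕ → ℂ} (hs : Admissible s) (a : Fin 3 → ℂ) :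
    ∃ o : ℕ → ℝ, Summable o ∧
      (∀ ω m k l, ‖cellData s a ω m k - cellData s a ω m l‖ ≤ o m) ∧
      ∀ ω m k l, ‖cellData s a ω (m + 1) k - cellData s a ω m l‖ ≤ o m := by
  obtain ⟨C, hC0, hC⟩ := exists_norm_cellData_le hs a
  set d : ℕ → ℝ := fun m => 2 * (deviation (s (m + 1)) * C) with hd
  have hd0 : ∀ m, 0 ≤ d m := fun m => by
    have := deviation_nonneg (s (m + 1))
    positivity
  have hds : Summable d := (hs.summable.mul_right C).mul_left 2
  have hdle : ∀ ω m, deviation (s (m + 1)) * ‖cellData s a ω m‖ ≤ deviation (s (m + 1)) * C :=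
    fun ω m => mul_le_mul_of_nonneg_left (hC ω m) (deviation_nonneg _)
  -- The majorant is the recursion of `extend_osc_le` with the uniform norm bound inserted, so it
  -- does not depend on the word.
  let o : ℕ → ℝ := fun m => Nat.rec (2 * ‖a‖) (fun m x => 11 / 15 * x + d m) m
  have ho0 : ∀ m, 0 ≤ o m := by
    intro m
    induction m with
    | zero =>
      change 0 ≤ 2 * ‖a‖
      positivity
    | succ m ih =>
      have := hd0 m
      change 0 ≤ 11 / 15 * o m + d m
      positivity
  have hos : Summable o :=
    summable_of_contraction (θ := 11 / 15) (by norm_num) ho0 hd0 hds fun m => le_rfl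
  have h1 : ∀ ω m k l, ‖cellData s a ω m k - cellData s a ω m l‖ ≤ o m := by
    intro ω m
    induction m with
    | zero =>
      intro k l
      have := norm_sub_le (a k) (a l)
      change ‖a k - a l‖ ≤ 2 * ‖a‖
      linarith [norm_le_pi_norm a k, norm_le_pi_norm a l]
    | succ m ih =>
      intro k l
      refine (extend_osc_le _ _ ih _ _ _).trans ?_
      change _ ≤ 11 / 15 * o m + d m
      have := hdle ω m
      simp only [hd]
      linarith
  refine ⟨fun m => o m + d m, hos.add hds, fun ω m k l => ?_, fun ω m k l => ?_⟩
  · have := h1 ω m k l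
    have := hd0 m
    linarith
  · refine (norm_extend_sub_le _ _ (h1 ω m) _ _ _).trans ?_
    have h2 := hdle ω m
    have h3 := deviation_nonneg (s (m + 1))
    have h4 : 0 ≤ deviation (s (m + 1)) * C := by positivity
    simp only [hd]
    linarith

/-- The limit of the boundary values along the cells of an infinite word. -/
def limitData (s : ℕ → ℂ) (a : Fin 3 → ℂ) (ω : ℕ → Fin 6) : ℂ :=
  a 0 + ∑' m, (cellData s a ω (m + 1) 0 - cellData s a ω m 0)

lemma continuous_limitData {s : ℕ → ℂ} (hs : Admissible s) (a : Fin 3 → ℂ) :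
    Continuous (limitData s a) := by
  obtain ⟨o, ho, -, h⟩ := exists_osc_cellData_le hs a
  refine continuous_const.add (continuous_tsum (fun m => ?_) ho fun m ω => h ω m 0 0)
  exact ((continuous_apply 0).comp (continuous_cellData s a (m + 1))).sub
    ((continuous_apply 0).comp (continuous_cellData s a m))

lemma tendsto_cellData {s : ℕ → ℂ} (hs : Admissible s) (a : Fin 3 → ℂ) (ω : ℕ → Fin 6)
    (k : Fin 3) : Tendsto (fun m => cellData s a ω m k) atTop (𝓝 (limitData s a ω)) := by
  obtain ⟨o, ho, h1, h2⟩ := exists_osc_cellData_le hs a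
  have hsum : Summable fun m => cellData s a ω (m + 1) 0 - cellData s a ω m 0 :=
    Summable.of_norm_bounded ho fun m => h2 ω m 0 0
  have h0 : Tendsto (fun m => cellData s a ω m 0) atTop (𝓝 (limitData s a ω)) := by
    refine (hsum.hasSum.tendsto_sum_nat.const_add (a 0)).congr fun m => ?_
    rw [Finset.sum_range_sub (fun m => cellData s a ω m 0)]
    simp [cellData]
  have hk : Tendsto (fun m => cellData s a ω m k - cellData s a ω m 0) atTop (𝓝 0) :=
    squeeze_zero_norm (fun m => h1 ω m k 0) ho.tendsto_atTop_zero
  simpa using hk.add h0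

lemma limitData_cons {s : ℕ → ℂ} (hs : Admissible s) (a : Fin 3 → ℂ) (j : Fin 6)
    (ω : ℕ → Fin 6) :
    limitData s a (cons j ω) = limitData (fun n => s (n + 1)) (extend (s 1) a j) ω := by
  refine tendsto_nhds_unique ((tendsto_add_atTop_iff_nat 1).2
    (tendsto_cellData hs a (cons j ω) 0)) ?_
  simp only [cellData_cons]
  exact tendsto_cellData hs.shift _ ω 0

lemma limitData_const {s : ℕ → ℂ} (hs : Admissible s) (a : Fin 3 → ℂ) (k : Fin 3) :
    limitData s a (fun _ => cornerIndex k) = a k := by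
  refine tendsto_nhds_unique (tendsto_cellData hs a _ k) ?_
  have : ∀ m, cellData s a (fun _ => cornerIndex k) m k = a k := by
    intro m
    induction m with
    | zero => rfl
    | succ m ih => rw [cellData, extend_cornerIndex, ih]
  simp only [this]
  exact tendsto_const_nhds

/-- Strip the common prefix of the two words. At the first difference the tails code corners, hence
are constant, and both cells assign the same value to the shared vertex. -/
lemma limitData_eq {s : ℕ → ℂ} (hs : Admissible s) (a : Fin 3 → ℂ) {ω ω' : ℕ → Fin 6}
    (h : coding ω = coding ω') : limitData s a ω = limitData s a ω' := by
  by_contra hne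
  have : ∃ n, ω n ≠ ω' n := by
    by_contra! h'
    exact hne (by rw [funext h'])
  obtain ⟨n, hn⟩ := this
  apply hne
  clear hne
  induction n using Nat.strong_induction_on generalizing s a ω ω' with
  | _ n ih =>
    rw [← cons_head_tail ω, ← cons_head_tail ω', limitData_cons hs, limitData_cons hs]
    rw [← cons_head_tail ω, ← cons_head_tail ω', coding_cons, coding_cons] at h
    by_cases h0 : ω 0 = ω' 0
    · rw [h0] at h ⊢
      cases n with
      | zero => exact absurd h0 hn
      | succ n => exact ih n (Nat.lt_succ_self n) hs.shift _ (F_injective _ h) hn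
    · obtain ⟨k, l, hk, hl, hkl⟩ := F_eq_F (coding_mem_X _) (coding_mem_X _) h0 h
      rw [eq_const_of_coding_eq_corner hk, eq_const_of_coding_eq_corner hl,
        limitData_const hs.shift, limitData_const hs.shift, extend, extend, hkl]

open Classical in
/-- The eigenfunction on `X` with boundary values `a` and parameters `s`. -/
def eigenfun (s : ℕ → ℂ) (a : Fin 3 → ℂ) (x : Plane) : ℂ :=
  if h : ∃ ω, coding ω = x then limitData s a h.choose else 0

lemma eigenfun_coding {s : ℕ → ℂ} (hs : Admissible s) (a : Fin 3 → ℂ) (ω : ℕ → Fin 6) :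
    eigenfun s a (coding ω) = limitData s a ω := by
  have h : ∃ ω', coding ω' = coding ω := ⟨ω, rfl⟩
  rw [eigenfun, dif_pos h]
  exact limitData_eq hs a h.choose_spec

lemma eigenfun_corner {s : ℕ → ℂ} (hs : Admissible s) (a : Fin 3 → ℂ) (k : Fin 3) :
    eigenfun s a (corner k) = a k := by
  rw [← coding_const_cornerIndex, eigenfun_coding hs, limitData_const hs]

lemma eigenfun_F {s : ℕ → ℂ} (hs : Admissible s) (a : Fin 3 → ℂ) (j : Fin 6) {x : Plane}
    (hx : x ∈ X) :
    eigenfun s a (F j x) = eigenfun (fun n => s (n + 1)) (extend (s 1) a j) x := by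
  rw [X_eq_range_coding] at hx
  obtain ⟨ω, rfl⟩ := hx
  rw [← coding_cons, eigenfun_coding hs, limitData_cons hs, eigenfun_coding hs.shift]

/-- Words form a compact space, so `coding` is a quotient map onto `X` and continuity can be tested
on words. -/
lemma continuousOn_eigenfun {s : ℕ → ℂ} (hs : Admissible s) (a : Fin 3 → ℂ) :
    ContinuousOn (eigenfun s a) X := by
  rw [continuousOn_iff_continuous_domRestrict]
  let g : (ℕ → Fin 6) → X := fun ω => ⟨coding ω, coding_mem_X ω⟩
  have hg : Continuous g := continuous_coding.subtype_mk _
  have hsurj : Function.Surjective g := by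
    rintro ⟨x, hx⟩
    rw [X_eq_range_coding] at hx
    obtain ⟨ω, rfl⟩ := hx
    exact ⟨ω, rfl⟩
  refine (hg.isClosedMap.isQuotientMap hg hsurj).continuous_iff.2 ?_
  refine (continuous_limitData hs a).congr fun ω => ?_
  exact (eigenfun_coding hs a ω).symm

/-! ### Decay of the decimation sequence and the product `tau`. -/

lemma IsDecimationSequence.isBigO {s : ℕ → ℂ} {lam : ℂ} (hs : IsDecimationSequence s lam) :
    s =O[atTop] fun m => (7 / 90 : ℝ) ^ m := by
  have h1 := hs.limit.isBigO_one ℝ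
  have h2 : (fun m : ℕ => (2 / 3 : ℂ) * (7 / 90) ^ m) =O[atTop] fun m => (7 / 90 : ℝ) ^ m := by
    refine Asymptotics.IsBigO.of_bound (2 / 3) (Eventually.of_forall fun m => ?_)
    simp
  have h3 := h2.mul h1
  simp only [mul_one] at h3
  refine h3.congr_left fun m => ?_
  have : (7 / 90 : ℂ) ^ m * (90 / 7) ^ m = 1 := by
    rw [← mul_pow]
    norm_num
  linear_combination s m * this

lemma IsDecimationSequence.tendsto_zero {s : ℕ → ℂ} {lam : ℂ} (hs : IsDecimationSequence s lam) :
    Tendsto s atTop (𝓝 0) :=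
  hs.isBigO.trans_tendsto (tendsto_pow_atTop_nhds_zero_of_lt_one (by norm_num) (by norm_num))

/-- Differentiability at `0` transfers the geometric decay of `s` to `f`. This serves both the
extension weights and the factors of the infinite product. -/
lemma IsDecimationSequence.summable_sub {s : ℕ → ℂ} {lam : ℂ} (hs : IsDecimationSequence s lam)
    {f : ℂ → ℂ} (hf : DifferentiableAt ℂ f 0) : Summable fun m => ‖f (s (m + 1)) - f 0‖ := by
  have h1 := hf.isBigO_sub.comp_tendsto hs.tendsto_zero
  simp only [Function.comp_def, sub_zero] at h1
  have h2 : Summable fun m => f (s m) - f 0 :=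
    summable_of_isBigO_nat (summable_geometric_of_lt_one (by norm_num) (by norm_num))
      (h1.trans hs.isBigO)
  exact (summable_nat_add_iff (f := fun m => ‖f (s m) - f 0‖) 1).2 h2.norm

lemma IsDecimationSequence.admissible {s : ℕ → ℂ} {lam : ℂ} (hs : IsDecimationSequence s lam) :
    Admissible s := by
  refine ⟨hs.relation, fun m => ⟨hs.ne_three m, hs.ne_five m, hs.ne_root m⟩, ?_⟩
  unfold deviation
  exact summable_sum fun n _ => summable_sum fun i _ =>
    hs.summable_sub (f := fun z => weight z n i) (differentiableAt_weight n i)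

lemma IsDecimationSequence.multipliable {s : ℕ → ℂ} {lam : ℂ}
    (hs : IsDecimationSequence s lam) : Multipliable fun j : ℕ => tauFactor (s (j + 1)) := by
  have hd : DifferentiableAt ℂ tauFactor 0 := by
    unfold tauFactor
    have : (1 - 3 / 2 * (0 : ℂ) + 0 ^ 2 / 4) ≠ 0 := by norm_num
    fun_prop (disch := exact this)
  have h0 : tauFactor 0 = 1 := by norm_num [tauFactor]
  have h := multipliable_one_add_of_summable (hs.summable_sub hd)
  simpa [h0] using h

lemma Admissible.ne_zero {s : ℕ → ℂ} (hs : Admissible s) (h0 : s 0 ≠ 0) (m : ℕ) : s m ≠ 0 := by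
  induction m with
  | zero => exact h0
  | succ m ih =>
    intro h
    have := hs.rel m
    rw [DecimationRel, h] at this
    apply ih
    linear_combination (-1 / 14) * this

lemma Admissible.prod_fluxFactor {s : ℕ → ℂ} (hs : Admissible s) (h0 : s 0 ≠ 0) (m : ℕ) :
    (r ^ m)⁻¹ * ∏ i ∈ Finset.range m, fluxFactor (s (i + 1)) =
      (90 / 7) ^ m * s m / s 0 * ∏ i ∈ Finset.range m, tauFactor (s (i + 1)) := by
  induction m with
  | zero => simp [h0]
  | succ m ih =>
    have hm := hs.ne_zero h0 m
    have e := fluxFactor_eq (hs.regular m) (hs.rel m) hm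
    rw [Finset.prod_range_succ, Finset.prod_range_succ, pow_succ, mul_inv]
    calc _ = ((r ^ m)⁻¹ * ∏ i ∈ Finset.range m, fluxFactor (s (i + 1))) *
          (r⁻¹ * fluxFactor (s (m + 1))) := by ring
      _ = _ := by
        rw [ih, e]
        field_simp
        ring

lemma IsDecimationSequence.tendsto_tau {s : ℕ → ℂ} {lam : ℂ} (hs : IsDecimationSequence s lam)
    (h0 : s 0 ≠ 0) :
    Tendsto (fun m : ℕ => (r ^ m)⁻¹ * ∏ i ∈ Finset.range m, fluxFactor (s (i + 1))) atTop
      (𝓝 (tau s lam)) := by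
  simp only [hs.admissible.prod_fluxFactor h0]
  have h1 := hs.limit.mul_const (2 / (3 * s 0))
  have h2 := h1.mul hs.multipliable.hasProd.tendsto_prod_nat
  rw [tau]
  have e : 2 * lam / (3 * s 0) = lam * (2 / (3 * s 0)) := by ring
  rw [e]
  refine h2.congr fun m => ?_
  congr 1
  field_simp

/-! ### Gauss–Green formula and normal derivatives. -/

lemma cellSum_congr (m : ℕ) {g g' : Plane → ℂ} (h : Set.EqOn g g' X) :
    cellSum m g = cellSum m g' := by
  induction m generalizing g g' with
  | zero => exact Finset.sum_congr rfl fun i _ => h (corner_mem_X i)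
  | succ m ih => exact Finset.sum_congr rfl fun j _ => ih fun x hx => h (F_mem_X hx j)

/-- The discrete Gauss–Green formula for `eigenfun`. -/
lemma graphEnergy_eigenfun {s : ℕ → ℂ} (hs : Admissible s) (a : Fin 3 → ℂ) (v : Plane → ℂ)
    (m : ℕ) : graphEnergy m (eigenfun s a) v =
      (r ^ m)⁻¹ * (s m / 2 * cellSum m (fun x => eigenfun s a x * v x) +
        (∏ i ∈ Finset.range m, fluxFactor (s (i + 1))) *
          ∑ k, v (corner k) * flux (s 0) a k) := by
  induction m generalizing s a v with
  | zero =>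
    rw [graphEnergy_zero (s 0)]
    simp [cellSum, eigenfun_corner hs]
  | succ m ih =>
    have h1 : ∀ j, graphEnergy m (eigenfun s a ∘ F j) (v ∘ F j) =
        (r ^ m)⁻¹ * (s (m + 1) / 2 * cellSum m ((fun x => eigenfun s a x * v x) ∘ F j) +
          (∏ i ∈ Finset.range m, fluxFactor (s (i + 1 + 1))) *
            ∑ k, v (nodePt (node j k)) * flux (s 1) (extend (s 1) a j) k) := by
      intro j
      rw [graphEnergy_congr m (u := eigenfun s a ∘ F j)
        (u' := eigenfun (fun n => s (n + 1)) (extend (s 1) a j)) (v' := v ∘ F j)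
        (fun x hx => eigenfun_F hs a j hx) fun x _ => rfl, ih hs.shift]
      congr 2
      · congr 1
        refine cellSum_congr m fun x hx => ?_
        simp only [Function.comp_apply, eigenfun_F hs a j hx]
      · simp only [Function.comp_apply, F_corner, zero_add]
    have h2 := sum_flux_extend (hs.regular 0) (hs.rel 0) a fun n => v (nodePt n)
    simp only [← corner_eq_nodePt, zero_add] at h2
    rw [graphEnergy]
    simp only [h1]
    rw [← Finset.mul_sum, Finset.sum_add_distrib, ← Finset.mul_sum, ← Finset.mul_sum, h2,
      Finset.prod_range_succ', cellSum, pow_succ, mul_inv]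
    ring

/-- The Gauss–Green formula for `eigenfun`. -/
lemma hasEnergy_eigenfun {s : ℕ → ℂ} {lam : ℂ} (hs : IsDecimationSequence s lam) (h0 : s 0 ≠ 0)
    (a : Fin 3 → ℂ) {v : Plane → ℂ} (hv : ContinuousOn v X) :
    HasEnergy (eigenfun s a) v (lam * ∫ x in X, eigenfun s a x * v x ∂μ +
      tau s lam * ∑ k, v (corner k) * flux (s 0) a k) := by
  have hA := hs.admissible
  have h1 := hs.limit.mul (tendsto_cellSum ((continuousOn_eigenfun hA a).mul hv))
  have h2 := (hs.tendsto_tau h0).mul_const (∑ k, v (corner k) * flux (s 0) a k)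
  refine (h1.add h2).congr fun m => ?_
  rw [graphEnergy_eigenfun hA, mul_add, mul_assoc (r ^ m)⁻¹]
  congr 1
  -- The number `6 ^ m` of cells normalizes the vertex sum, and `6 / r = 90/7`.
  have e : (90 / 7 : ℂ) ^ m = (r ^ m)⁻¹ * 6 ^ m := by
    rw [← inv_pow, ← mul_pow]
    norm_num [r]
  have h6 : (6 : ℂ) ^ m ≠ 0 := by simp
  rw [e]
  change 3 / 2 * ((r ^ m)⁻¹ * 6 ^ m) * s m * (cellSum m (fun x => eigenfun s a x * v x) /
    (3 * 6 ^ m)) = _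
  field_simp

/-- Gauss–Green tested against the conjugate function shows that the energies converge; hence they
are bounded. -/
lemma inDomEnergy_eigenfun {s : ℕ → ℂ} {lam : ℂ} (hs : IsDecimationSequence s lam)
    (h0 : s 0 ≠ 0) (a : Fin 3 → ℂ) : InDomEnergy (eigenfun s a) := by
  have hc := continuousOn_eigenfun hs.admissible a
  refine ⟨hc, ?_⟩
  have h := hasEnergy_eigenfun hs h0 a (v := fun x => starRingEnd ℂ (eigenfun s a x))
    (Complex.continuous_conj.comp_continuousOn hc)
  obtain ⟨C, hC⟩ := h.norm.bddAbove_range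
  exact ⟨C, fun m => hC ⟨m, rfl⟩⟩

/-- The normal derivatives of `eigenfun`. -/
lemma hasNormalDeriv_eigenfun {s : ℕ → ℂ} {lam : ℂ} (hs : IsDecimationSequence s lam)
    (h0 : s 0 ≠ 0) (a : Fin 3 → ℂ) (k : Fin 3) :
    HasNormalDeriv (eigenfun s a) k (tau s lam * flux (s 0) a k) := by
  have hA := hs.admissible
  -- The sequence and the boundary values are quantified, since passing to the corner cell shifts
  -- the one and extends the other.
  have hval : ∀ m (s : ℕ → ℂ), Admissible s → ∀ (a : Fin 3 → ℂ), ∑ l, (eigenfun s a (corner k) -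
      eigenfun s a ((F (cornerIndex k))^[m] (corner l))) =
      (∏ i ∈ Finset.range m, fluxFactor (s (i + 1))) * flux (s 0) a k + s m / 2 * a k := by
    intro m
    induction m with
    | zero =>
      intro s hs a
      simp [eigenfun_corner hs, flux]
      ring
    | succ m ih =>
      intro s hs a
      have hX : ∀ l, (F (cornerIndex k))^[m] (corner l) ∈ X := by
        intro l
        have : Set.MapsTo (F (cornerIndex k)) X X := fun x hx => F_mem_X hx _
        exact this.iterate m (corner_mem_X l)
      simp only [Function.iterate_succ', Function.comp_apply, eigenfun_F hs a _ (hX _)]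
      have h1 := ih _ hs.shift (extend (s 1) a (cornerIndex k))
      simp only [eigenfun_corner hs.shift, extend_cornerIndex] at h1
      rw [eigenfun_corner hs, h1, Finset.prod_range_succ', zero_add,
        flux_extend (hs.regular 0) (hs.rel 0)]
      ring
  -- The mass at a single vertex is negligible: `(90/7) ^ m * s m` converges, and a factor `(1/6) ^
  -- m` is left over.
  have hlim : Tendsto (fun m : ℕ => (r ^ m)⁻¹ * (s m / 2 * a k)) atTop (𝓝 0) := by
    have h1 := hs.limit.mul_const (a k / 3)
    have h2 : Tendsto (fun m : ℕ => (1 / 6 : ℂ) ^ m) atTop (𝓝 0) :=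
      tendsto_pow_atTop_nhds_zero_of_norm_lt_one (by norm_num)
    have h3 := h2.mul h1
    rw [zero_mul] at h3
    refine h3.congr fun m => ?_
    have e : (r ^ m)⁻¹ = (1 / 6 : ℂ) ^ m * (90 / 7) ^ m := by
      rw [← inv_pow, ← mul_pow]
      norm_num [r]
    rw [e]
    ring
  have h2 := ((hs.tendsto_tau h0).mul_const (flux (s 0) a k)).add hlim
  rw [add_zero] at h2
  refine h2.congr fun m => ?_
  rw [hval m s hA a]
  ring

/-- Away from the Dirichlet spectrum, eigenfunctions are determined by their boundary values. -/
lemma eqOn_eigenfun {s : ℕ → ℂ} {lam κ : ℂ} (hs : IsDecimationSequence s lam) (h0 : s 0 ≠ 0)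
    (hκ : lam = -κ) (hD : ¬ IsDirichletEigenvalue κ) {u : Plane → ℂ}
    (hu : HasLaplacianOn [] u fun x => κ * u x) :
    Set.EqOn u (eigenfun s fun k => u (corner k)) X := by
  set w := eigenfun s fun k => u (corner k) with hw
  have hwd : InDomEnergy w := inDomEnergy_eigenfun hs h0 _
  intro x hx
  by_contra hne
  apply hD
  have hd : InDomEnergy fun x => u x - w x := hu.1.sub hwd
  -- If `u` and `w` differed somewhere, their difference would be a Dirichlet eigenfunction.
  refine ⟨fun x => u x - w x, ⟨x, hx, sub_ne_zero.2 hne⟩, ?_, hd,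
    continuousOn_const.mul hd.continuousOn, fun v hv hb ho => ?_⟩
  · rw [V_zero_eq]
    rintro _ ⟨k, rfl⟩
    simp only [hw, eigenfun_corner hs.admissible, sub_self]
  · have e1 := hu.2.2 v hv hb ho
    have e2 : HasEnergy w v _ := hasEnergy_eigenfun hs h0 (fun k => u (corner k)) hv.continuousOn
    have hz : ∀ k, v (corner k) = 0 := fun k => hb _ (mem_cellBoundary_nil.2 ⟨k, rfl⟩)
    simp only [hz, zero_mul, Finset.sum_const_zero, mul_zero, add_zero] at e2
    have e3 := Tendsto.sub e1 e2
    simp only [← graphEnergy_sub_left] at e3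
    have hi : ∀ {g : Plane → ℂ}, ContinuousOn g X → IntegrableOn g X μ := by
      intro g hg
      have hX : MeasurableSet X := isCompact_X.isClosed.measurableSet
      have : IsFiniteMeasure μ := by rw [μ_eq]; infer_instance
      exact hg.integrableOn_compact isCompact_X
    have e : -∫ x in X, κ * (u x - w x) * v x ∂μ =
        -∫ x in X, κ * u x * v x ∂μ - lam * ∫ x in X, w x * v x ∂μ := by
      rw [← integral_const_mul, hκ, neg_sub_left, ← integral_add]
      · congr 2
        funext x
        ring
      · exact hi (continuousOn_const.mul (hwd.continuousOn.mul hv.continuousOn))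
      · exact hi ((continuousOn_const.mul hu.1.continuousOn).mul hv.continuousOn)
    change Tendsto _ _ (𝓝 (-∫ x in X, κ * (u x - w x) * v x ∂μ))
    rw [e]
    exact e3

/-! ### The solutions at level one and the matrix `B`. -/

/-- The indicator function of a label. -/
def nodeInd (n n' : Fin 10) : ℂ := if n' = n then 1 else 0

lemma IsLevelOneSolution.apply_nodePt {Λ : ℂ} {n : Fin 10} {ψ : Plane → ℂ}
    (h : IsLevelOneSolution Λ (nodePt n) ψ) (n' : Fin 10) : ψ (nodePt n') = nodeInd n n' := by
  unfold nodeInd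
  split_ifs with hn
  · rw [hn, h.2.1]
  · exact h.2.2 _ (V_one_eq ▸ ⟨n', rfl⟩) fun h => hn (nodePt_injective h)

lemma IsLevelOneSolution.eqOn {s : ℕ → ℂ} {lam Lam : ℂ} (hs : IsDecimationSequence s lam)
    (h0 : s 0 ≠ 0) (hLam : lam = -(r * (1 / 6) * Lam))
    (hD : ¬ IsDirichletEigenvalue (r * (1 / 6) * Lam)) {n : Fin 10} {ψ : Plane → ℂ}
    (h : IsLevelOneSolution Lam (nodePt n) ψ) (j : Fin 6) :
    Set.EqOn (ψ ∘ F j) (eigenfun s fun k => nodeInd n (node j k)) X := by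
  have := eqOn_eigenfun hs h0 hLam hD (h.1 j).comp_F
  simpa only [Function.comp_apply, F_corner, h.apply_nodePt] using this

/-- Six eigenfunctions are glued along `V 1`. No matching of normal derivatives is needed, because a
test function for one cell vanishes on its boundary and removes the boundary term. -/
lemma exists_isLevelOneSolution {s : ℕ → ℂ} {lam Lam : ℂ} (hs : IsDecimationSequence s lam)
    (h0 : s 0 ≠ 0) (hLam : lam = -(r * (1 / 6) * Lam)) (n : Fin 10) :
    ∃ ψ, IsLevelOneSolution Lam (nodePt n) ψ := by
  set U : Fin 6 → Plane → ℂ := fun j => eigenfun s fun k => nodeInd n (node j k) with hU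
  have hUd : ∀ j, InDomEnergy (U j) := fun j => inDomEnergy_eigenfun hs h0 _
  obtain ⟨ψ, hc, hψ⟩ := exists_glue U (fun j => (hUd j).continuousOn) (nodeInd n)
    fun j k => eigenfun_corner hs.admissible _ k
  have hψd : InDomEnergy ψ :=
    InDomEnergy.of_comp_F hc fun j => (hUd j).congr fun x hx => hψ j x hx
  have hval : ∀ n', ψ (nodePt n') = nodeInd n n' := by
    intro n'
    have : ∀ n', ∃ j k, node j k = n' := by decide
    obtain ⟨j, k, rfl⟩ := this n'
    rw [← F_corner, hψ j _ (corner_mem_X k)]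
    exact eigenfun_corner hs.admissible _ k
  refine ⟨ψ, fun j => ⟨hψd, continuousOn_const.mul hc, fun v hv hb ho => ?_⟩, ?_, ?_⟩
  · have hother : ∀ i, i ≠ j → ∀ x ∈ X, v (F i x) = 0 := fun i hi x hx =>
      eq_zero_on_other_cell hb ho hi hx
    have hz : ∀ k, (v ∘ F j) (corner k) = 0 := fun k =>
      hb _ (mem_cellBoundary_singleton.2 ⟨k, rfl⟩)
    have e2 : HasEnergy (U j) (v ∘ F j) _ :=
      hasEnergy_eigenfun hs h0 _ (hv.comp_F j).continuousOn
    simp only [hz, zero_mul, Finset.sum_const_zero, mul_zero, add_zero] at e2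
    have hX : MeasurableSet X := isCompact_X.isClosed.measurableSet
    have e : -∫ x in X, Lam * ψ x * v x ∂μ = r⁻¹ * (lam * ∫ x in X, U j x * (v ∘ F j) x ∂μ) := by
      rw [integral_X_of_zero (g := fun x => Lam * ψ x * v x)
        ((continuousOn_const.mul hc).mul hv.continuousOn) j
        fun i hi x hx => by simp only [hother i hi x hx, mul_zero]]
      have : ∫ x in X, Lam * ψ (F j x) * v (F j x) ∂μ =
          Lam * ∫ x in X, U j x * (v ∘ F j) x ∂μ := by
        rw [← integral_const_mul]
        refine setIntegral_congr_fun hX fun x hx => ?_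
        simp only [hψ j x hx, Function.comp_apply, mul_assoc]
      rw [this, hLam]
      have := r_ne_zero
      field_simp
    change Tendsto _ _ (𝓝 (-∫ x in X, Lam * ψ x * v x ∂μ))
    rw [e]
    refine (tendsto_add_atTop_iff_nat 1).1 ((Tendsto.const_mul r⁻¹ e2).congr fun m => ?_)
    rw [graphEnergy_succ_of_zero m ψ v j hother]
    congr 1
    exact graphEnergy_congr m (fun x hx => (hψ j x hx).symm) fun _ _ => rfl
  · rw [hval, nodeInd, if_pos rfl]
  · rw [V_one_eq]
    rintro _ ⟨n', rfl⟩ hne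
    rw [hval, nodeInd, if_neg]
    rintro rfl
    exact hne rfl

/-- The entries of the matrix `B`, in terms of labels. -/
def nodeMatrix (z t : ℂ) (n n' : Fin 10) : ℂ :=
  ∑ j, ∑ k, if node j k = n' then r⁻¹ * (t * flux z (fun l => nodeInd n (node j l)) k) else 0

lemma node_injective (j : Fin 6) : Function.Injective (node j) := by
  intro k l; revert j k l; decide

lemma IsLevelOneSolution.hasNormalDerivSum {s : ℕ → ℂ} {lam Lam : ℂ}
    (hs : IsDecimationSequence s lam) (h0 : s 0 ≠ 0) (hLam : lam = -(r * (1 / 6) * Lam))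
    (hD : ¬ IsDirichletEigenvalue (r * (1 / 6) * Lam)) {n : Fin 10} {ψ : Plane → ℂ}
    (h : IsLevelOneSolution Lam (nodePt n) ψ) (n' : Fin 10) :
    HasNormalDerivSum ψ (nodePt n') (nodeMatrix (s 0) (tau s lam) n n') := by
  -- Since `node j` is injective, at most one term of the sum over `k` is nonzero: the derivative
  -- from `K_j` if the vertex lies in that cell, and `0` otherwise.
  refine ⟨fun j => ∑ k, if node j k = n' then
    r⁻¹ * (tau s lam * flux (s 0) (fun l => nodeInd n (node j l)) k) else 0, ?_, ?_, rfl⟩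
  · rintro j ⟨y, hy, hyn⟩
    obtain ⟨k, rfl, hk⟩ := F_eq_nodePt hy hyn
    refine ⟨k, tau s lam * flux (s 0) (fun l => nodeInd n (node j l)) k, hyn.symm, ?_, ?_⟩
    · have hE := IsLevelOneSolution.eqOn hs h0 hLam hD h j
      refine (hasNormalDeriv_eigenfun hs h0 (fun l => nodeInd n (node j l)) k).congr fun m => ?_
      congr 1
      refine Finset.sum_congr rfl fun l _ => ?_
      have hm : Set.MapsTo (F (cornerIndex k)) X X := fun x hx => F_mem_X hx _
      rw [hE (corner_mem_X k), hE (hm.iterate m (corner_mem_X l))]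
    · beta_reduce
      rw [Finset.sum_eq_single k]
      · rw [if_pos hk]
      · intro l _ hl
        rw [if_neg]
        intro h'
        exact hl (node_injective j (h'.trans hk.symm))
      · simp
  · intro j hj
    refine Finset.sum_eq_zero fun k _ => if_neg ?_
    rintro rfl
    exact hj ⟨corner k, corner_mem_X k, F_corner j k⟩

/-- The number of `1`-cells that contain both of two labelled points. -/
def cellCount (n n' : Fin 10) : ℕ :=
  ∑ j, ∑ k, ∑ l, if node j k = n' ∧ node j l = n then 1 else 0

/-- With indicator data, both terms of `flux` become incidence indicators, so summing over the cells
leaves only counts. -/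
lemma nodeMatrix_eq (z t : ℂ) (n n' : Fin 10) : nodeMatrix z t n n' =
    r⁻¹ * t * ((3 - z / 2) * (if n = n' then (cellCount n n : ℂ) else 0) - cellCount n n') := by
  have hc : ∀ n, (cellCount n n : ℕ) = ∑ j, ∑ k, if node j k = n then 1 else 0 := by decide
  have hterm : ∀ j k, (if node j k = n' then
      r⁻¹ * (t * flux z (fun l => nodeInd n (node j l)) k) else 0) =
      r⁻¹ * t * ((3 - z / 2) * (if n = n' then (if node j k = n then 1 else 0) else 0) -
        ∑ l, if node j k = n' ∧ node j l = n then 1 else 0) := by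
    intro j k
    by_cases h : node j k = n'
    · by_cases hn : n = n'
      · subst hn
        simp only [h, flux, nodeInd, if_true, true_and]
        ring
      · have : n' ≠ n := fun h => hn h.symm
        simp only [h, flux, nodeInd, if_true, true_and, hn, this, if_false]
        ring
    · by_cases hn : n = n'
      · subst hn
        simp [h]
      · simp [h, hn]
  rw [nodeMatrix]
  simp only [hterm]
  simp only [← Finset.mul_sum, Finset.sum_sub_distrib]
  congr 2
  · congr 1
    split_ifs
    · rw [hc]
      push_cast
      rfl
    · simp
  · rw [cellCount]
    push_cast
    rfl

end SG3

end

theorem mainTheorem8 (s : ℕ → ℂ) (lam Lam : ℂ)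
    (hs : SG3.IsDecimationSequence s lam) (hs0 : s 0 ≠ 0)
    (hLam : lam = -(SG3.r * (1 / 6) * Lam))
    (hD : ¬ SG3.IsDirichletEigenvalue (SG3.r * (1 / 6) * Lam)) :
    Multipliable (fun j : ℕ => SG3.tauFactor (s (j + 1))) ∧
    ∃ B : SG3.Plane → SG3.Plane → ℂ, SG3.IsBMatrix Lam B ∧
      (∀ p ∈ SG3.V 1 \ SG3.V 0, ∀ q ∈ SG3.V 1, SG3.Neighbour 1 p q →
        B p q = -(SG3.r⁻¹ * SG3.tau s lam)) ∧
      B SG3.center SG3.center = 3 / 2 * SG3.r⁻¹ * (4 - s 0) * SG3.tau s lam ∧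
      (∀ p ∈ SG3.V 1 \ SG3.V 0, p ≠ SG3.center →
        B p p = SG3.r⁻¹ * (4 - s 0) * SG3.tau s lam) := by
  obtain ⟨B, hB⟩ : ∃ B : SG3.Plane → SG3.Plane → ℂ, ∀ n n',
      B (SG3.nodePt n) (SG3.nodePt n') = SG3.nodeMatrix (s 0) (SG3.tau s lam) n n' := by
    -- Only values of `B` on `V 1` matter; elsewhere the inverse of `nodePt` is arbitrary.
    have hinv := Function.leftInverse_invFun SG3.nodePt_injective
    exact ⟨fun p q => SG3.nodeMatrix (s 0) (SG3.tau s lam) (Function.invFun SG3.nodePt p)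
      (Function.invFun SG3.nodePt q), fun n n' => by simp only [hinv n, hinv n']⟩
  refine ⟨hs.multipliable, B, ?_, ?_, ?_, ?_⟩
  · rintro p ⟨hp, -⟩
    rw [SG3.V_one_eq] at hp
    obtain ⟨n, rfl⟩ := hp
    refine ⟨SG3.exists_isLevelOneSolution hs hs0 hLam n, fun ψ hψ q hq => ?_⟩
    rw [SG3.V_one_eq] at hq
    obtain ⟨n', rfl⟩ := hq
    rw [hB]
    exact hψ.hasNormalDerivSum hs hs0 hLam hD n'
  · rintro p - q - ⟨hne, w, hw, hpw, hqw⟩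
    obtain ⟨j, rfl⟩ := List.length_eq_one_iff.1 hw
    obtain ⟨k, rfl⟩ := SG3.mem_cellBoundary_singleton.1 hpw
    obtain ⟨l, rfl⟩ := SG3.mem_cellBoundary_singleton.1 hqw
    have hkl : k ≠ l := fun h => hne (by rw [h])
    have hn : SG3.node j k ≠ SG3.node j l := fun h => hkl (SG3.node_injective j h)
    have hc : ∀ j k l, k ≠ l → SG3.cellCount (SG3.node j k) (SG3.node j l) = 1 := by decide
    rw [SG3.F_corner, SG3.F_corner, hB, SG3.nodeMatrix_eq, if_neg hn, hc j k l hkl]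
    push_cast
    ring
  · have hc : SG3.cellCount 9 9 = 3 := by decide
    rw [SG3.center_eq_nodePt, hB, SG3.nodeMatrix_eq, if_pos rfl, hc]
    push_cast
    ring
  · rintro p ⟨hp, hp0⟩ hpc
    rw [SG3.V_one_eq] at hp
    obtain ⟨n, rfl⟩ := hp
    rw [SG3.center_eq_nodePt] at hpc
    have h9 : n ≠ 9 := fun h => hpc (by rw [h])
    have hk : ∀ k : Fin 3, n ≠ Fin.castLE (by norm_num) k := by
      rintro k rfl
      exact hp0 (SG3.V_zero_eq ▸ ⟨k, SG3.corner_eq_nodePt k⟩)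
    have hc : ∀ n : Fin 10, n ≠ 9 → (∀ k : Fin 3, n ≠ Fin.castLE (by norm_num) k) →
        SG3.cellCount n n = 2 := by decide
    rw [hB, SG3.nodeMatrix_eq, if_pos rfl, hc n h9 hk]
    push_cast
    ring
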